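/- **Setting.** A spacetime $(M,g)$ is a connected, Hausdorff, second countable smooth manifold $M$ of finite dimension with a continuous Lorentzian metric $g$ of signature $(-,+,\dots,+)$ and a time orientation given by a continuous $g$-timelike vector field. A tangent vector $v\neq 0$ is causal if $g(v,v)\le 0$ and timelike if $g(v,v)<0$. A future-directed causal curve is a locally Lipschitz curve on an interval whose tangent vector exists and is causal and future-directed for almost every parameter; it is inextendible if it has neither a future nor a past endpoint in $M$. For continuous Lorentzian metrics we write $\hat g\succ g$ if at every point each $g$-causal vector is $\hat g$-timelike; $\hat g$ then carries the time orientation given by the same vector field. $(M,g)$ is stably causal if there is a continuous Lorentzian metric $\tilde g\succ g$ without closed causal curves. A ($g$-)time function is a continuous function $M\to\mathbb R$ that is strictly increasing along every future-directed $g$-causal curve; it is Cauchy if it is onto $\mathbb R$ and each of its level sets is met exactly once by every inextendible $g$-causal curve. Fix a smooth Riemannian metric $h$ on $M$. A function $\tau$ is locally $\hat g$-anti-Lipschitz if every $p\in M$ has a relatively compact neighbourhood $O$ and a constant $C>0$ such that $\tau(\gamma(s_2))-\tau(\gamma(s_1))\ge C\,(s_2-s_1)$ for all $s_1\le s_2$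 and every future-directed $\hat g$-causal curve $\gamma$ with image in $O$ parametrised by $h$-arc length. **Theorem.** Let $(M,g)$ be a stably causal spacetime with a continuous metric $g$, and let $\tau$ be a time function on $M$. Suppose that there is a continuous Lorentzian metric $\hat g\succ g$ such that $\tau$ is locally $\hat g$-anti-Lipschitz. Then for every function $\alpha:M\to(0,\infty)$ that is bounded below by a positive constant on each compact subset of $M$ (for instance, every continuous $\alpha:M\to(0,\infty)$) there is a smooth $g$-time function $\hat\tau$ whose $g$-gradient is everywhere timelike and such that $|\hat\tau-\tau|<\alpha$ on $M$. If $\tau$ is Cauchy, then $\hat\tau$ can moreover be chosen Cauchy. -/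

import Mathlib

open Bundle Set Filter Topology MeasureTheory
open scoped Manifold ContDiff

namespace Spacetime

section Metrics

variable (E : Type*) [NormedAddCommGroup E] [NormedSpace ℝ E]
  (M : Type*) [TopologicalSpace M] [ChartedSpace E M] [IsManifold 𝓘(ℝ, E) ∞ M]

/-- A continuous Lorentzian metric of signature `(-,+,…,+)` on the manifold `M` modelled on `E`:
a continuous field of symmetric bilinear forms on the tangent spaces, each of which has a vector
of negative square on whose orthogonal complement the form is positive definite. -/
structure LorentzMetric where
  /-- The bilinear form on the tangent space at `p`. -/
  val (p : M) : TangentSpace 𝓘(ℝ, E) p →L[ℝ] TangentSpace 𝓘(ℝ, E) p →L[ℝ] ℝ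
  symm (p : M) (v w : TangentSpace 𝓘(ℝ, E) p) : val p v w = val p w v
  lorentzian (p : M) : ∃ v : TangentSpace 𝓘(ℝ, E) p, val p v v < 0 ∧
    ∀ w : TangentSpace 𝓘(ℝ, E) p, val p v w = 0 → w ≠ 0 → 0 < val p w w
  continuous : Continuous (fun p : M ↦ TotalSpace.mk' (E →L[ℝ] E →L[ℝ] ℝ)
    (E := fun p : M ↦ TangentSpace 𝓘(ℝ, E) p →L[ℝ] TangentSpace 𝓘(ℝ, E) p →L[ℝ] ℝ) p (val p))

/-- A smooth Riemannian metric on the manifold `M`. -/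
abbrev SmoothRiemannianMetric :=
  ContMDiffRiemannianMetric 𝓘(ℝ, E) ∞ E (fun p : M ↦ TangentSpace 𝓘(ℝ, E) p)

end Metrics

variable {E : Type*} [NormedAddCommGroup E] [NormedSpace ℝ E]
  {M : Type*} [TopologicalSpace M] [ChartedSpace E M] [IsManifold 𝓘(ℝ, E) ∞ M]

/-- The vector `v` is `g`-timelike. -/
def IsTimelike (g : LorentzMetric E M) {p : M} (v : TangentSpace 𝓘(ℝ, E) p) : Prop :=
  g.val p v v < 0

/-- The vector `v` is `g`-causal (timelike or null; the zero vector is neither). -/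
def IsCausal (g : LorentzMetric E M) {p : M} (v : TangentSpace 𝓘(ℝ, E) p) : Prop :=
  v ≠ 0 ∧ g.val p v v ≤ 0

/-- `Wider g g'` means `g' ≻ g`: at every point the causal cone of `g` is contained in the
timelike cone of `g'`. -/
def Wider (g g' : LorentzMetric E M) : Prop :=
  ∀ (p : M) (v : TangentSpace 𝓘(ℝ, E) p), IsCausal g v → IsTimelike g' v

theorem IsTimelike.isCausal {g : LorentzMetric E M} {p : M} {v : TangentSpace 𝓘(ℝ, E) p}
    (hv : IsTimelike g v) : IsCausal g v := by
  refine ⟨?_, le_of_lt hv⟩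
  rintro rfl
  simp [IsTimelike] at hv

/-- A time orientation of `(M, g)`: a continuous timelike vector field, which is declared to be
future-directed. -/
structure TimeOrientation (g : LorentzMetric E M) where
  /-- The value of the vector field at `p`. -/
  field (p : M) : TangentSpace 𝓘(ℝ, E) p
  timelike (p : M) : IsTimelike g (field p)
  continuous : Continuous (fun p : M ↦ (⟨p, field p⟩ : TangentBundle 𝓘(ℝ, E) M))

/-- A metric with wider light cones inherits the time orientation: the same vector field is
timelike for it, so that future-directed `g`-causal vectors are future-directed for `g'`. -/
def TimeOrientation.widen {g g' : LorentzMetric E M} (T : TimeOrientation g)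
    (hg : Wider g g') : TimeOrientation g' where
  field := T.field
  timelike p := hg p _ (T.timelike p).isCausal
  continuous := T.continuous

/-- The vector `v` is `g`-causal and future-directed. -/
def IsFutureCausal (g : LorentzMetric E M) (T : TimeOrientation g) {p : M}
    (v : TangentSpace 𝓘(ℝ, E) p) : Prop :=
  IsCausal g v ∧ g.val p v (T.field p) < 0

/-- The curve `γ` is differentiable at the parameter `t`, with tangent vector `v`. -/
def HasVelocityAt (γ : ℝ → M) (t : ℝ) (v : TangentSpace 𝓘(ℝ, E) (γ t)) : Prop :=
  HasMFDerivAt 𝓘(ℝ, ℝ) 𝓘(ℝ, E) γ t ((1 : ℝ →L[ℝ] ℝ).smulRight v)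

/-- The curve `γ` is continuous on `I` and locally Lipschitz there, measured in charts. -/
def IsLocallyLipschitzCurve (E : Type*) [NormedAddCommGroup E] {M : Type*} [TopologicalSpace M]
    [ChartedSpace E M] (γ : ℝ → M) (I : Set ℝ) : Prop :=
  ContinuousOn γ I ∧
    ∀ t ∈ I, ∃ K, ∃ U ∈ 𝓝[I] t, LipschitzOnWith K (fun s ↦ chartAt E (γ t) (γ s)) U

/-- `γ`, defined on the interval `I`, is a future-directed `g`-causal curve: it is locally
Lipschitz, and for almost every parameter it has a tangent vector, which is causal and
future-directed. (Past-directed causal curves are those obtained by reversing the parameter.) -/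
def IsFutureCausalCurve (g : LorentzMetric E M) (T : TimeOrientation g)
    (γ : ℝ → M) (I : Set ℝ) : Prop :=
  I.OrdConnected ∧ IsLocallyLipschitzCurve E γ I ∧
    ∀ᵐ t : ℝ, t ∈ I → ∃ v, HasVelocityAt γ t v ∧ IsFutureCausal g T v

/-- `γ`, defined on the interval `I`, is parametrised by arc length of the Riemannian metric `h`:
its tangent vector has `h`-length one for almost every parameter. -/
def IsArclengthParametrised (h : SmoothRiemannianMetric E M) (γ : ℝ → M) (I : Set ℝ) : Prop :=
  ∀ᵐ t : ℝ, t ∈ I → ∃ v, HasVelocityAt γ t v ∧ h.inner (γ t) v v = 1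

/-- `γ`, defined on the interval `I`, has neither a future nor a past endpoint: it converges
to no point of `M` as the parameter tends to the upper end of `I`, nor as it tends to the
lower end. (If the end belongs to `I`, then the curve does converge there.) -/
def IsInextendible (γ : ℝ → M) (I : Set ℝ) : Prop :=
  (¬ ∃ p, Tendsto (fun t : I ↦ γ t) atTop (𝓝 p)) ∧
    ¬ ∃ p, Tendsto (fun t : I ↦ γ t) atBot (𝓝 p)

/-- `(M, g)` is causal: it contains no closed causal curve. -/
def IsCausalSpacetime (g : LorentzMetric E M) (T : TimeOrientation g) : Prop :=
  ¬ ∃ (γ : ℝ → M) (a b : ℝ), a < b ∧ IsFutureCausalCurve g T γ (Icc a b) ∧ γ a = γ b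

/-- `(M, g)` is stably causal: `(M, g')` is causal for some metric `g' ≻ g`. -/
def IsStablyCausal (g : LorentzMetric E M) (T : TimeOrientation g) : Prop :=
  ∃ (g' : LorentzMetric E M) (hg : Wider g g'), IsCausalSpacetime g' (T.widen hg)

/-- `τ` is a time function: continuous, and increasing along every future-directed causal
curve. -/
def IsTimeFunction (g : LorentzMetric E M) (T : TimeOrientation g) (τ : M → ℝ) : Prop :=
  Continuous τ ∧ ∀ (γ : ℝ → M) (I : Set ℝ), IsFutureCausalCurve g T γ I →
    StrictMonoOn (fun t ↦ τ (γ t)) I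

/-- `τ` is a Cauchy time function: a time function onto `ℝ` whose level sets are met exactly
once by every inextendible causal curve. -/
def IsCauchyTimeFunction (g : LorentzMetric E M) (T : TimeOrientation g) (τ : M → ℝ) : Prop :=
  IsTimeFunction g T τ ∧ Function.Surjective τ ∧
    ∀ (γ : ℝ → M) (I : Set ℝ), IsFutureCausalCurve g T γ I → IsInextendible γ I →
      ∀ r : ℝ, ∃! t, t ∈ I ∧ τ (γ t) = r

/-- `τ` is locally `g`-anti-Lipschitz (with respect to the auxiliary Riemannian metric `h`):
every point has a relatively compact neighbourhood `O` and a constant `C > 0` such that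
`τ (γ s₂) - τ (γ s₁) ≥ C (s₂ - s₁)` for `s₁ ≤ s₂` along every future-directed `g`-causal curve
`γ` in `O` that is parametrised by `h`-arc length. -/
def IsLocallyAntiLipschitz (h : SmoothRiemannianMetric E M) (g : LorentzMetric E M)
    (T : TimeOrientation g) (τ : M → ℝ) : Prop :=
  ∀ p : M, ∃ O ∈ 𝓝 p, IsCompact (closure O) ∧ ∃ C : ℝ, 0 < C ∧
    ∀ (γ : ℝ → M) (I : Set ℝ), IsFutureCausalCurve g T γ I → IsArclengthParametrised h γ I →
      MapsTo γ I O → ∀ s₁ ∈ I, ∀ s₂ ∈ I, s₁ ≤ s₂ → C * (s₂ - s₁) ≤ τ (γ s₂) - τ (γ s₁)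

/-- The vector `v` at `p` is the `g`-gradient of `f` at `p`, that is, `g(v, ·) = df`. -/
def IsGradientAt (g : LorentzMetric E M) (f : M → ℝ) (p : M) (v : TangentSpace 𝓘(ℝ, E) p) :
    Prop :=
  ∀ w : TangentSpace 𝓘(ℝ, E) p, g.val p v w = mfderiv 𝓘(ℝ, E) 𝓘(ℝ, ℝ) f p w

/-- The `g`-gradient of `f` is timelike at every point. -/
def HasTimelikeGradient (g : LorentzMetric E M) (f : M → ℝ) : Prop :=
  ∀ p : M, ∃ v : TangentSpace 𝓘(ℝ, E) p, IsGradientAt g f p v ∧ IsTimelike g v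

end Spacetime

/-! In a chart around a point, the frame coordinates of every `g`-causal direction at one nearby
point are `g'`-causal at all nearby points, because the cones of `g'` are strictly wider and both
metrics are continuous. A coordinate segment in such a direction is therefore a `g'`-causal curve,
and the anti-Lipschitz bound makes `τ` increase along it at a definite rate. Such a bound on
increments is translation invariant, so mollification in the chart preserves it and turns it into a
lower bound `c` on the derivative in every `g`-causal direction
(`IsLocallyAntiLipschitz.exists_local_smoothing`). The decisive point is that `c` does not depend on
the accuracy `ε` of the mollification.

The local functions are glued by a partition of unity. The derivatives of the weights sum to zero,
so they only multiply the errors `F q - τ`. These are chosen small after the rates and the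
derivatives of the weights are known, and the positive terms win (`exists_smooth_approximation`). A
differential that is positive on the future causal cone has a timelike gradient
(`exists_timelike_gradient`) and makes the function increase along Lipschitz causal curves
(`isTimeFunction_of_dirDeriv_pos`). The Cauchy property survives any bounded perturbation among time
functions, by the intermediate value theorem. -/

namespace Spacetime

/-! ### Linear algebra of Lorentzian cones -/

section LinearAlgebra

variable {E : Type*} [NormedAddCommGroup E] [NormedSpace ℝ E]
  {M : Type*} [TopologicalSpace M] [ChartedSpace E M] [IsManifold 𝓘(ℝ, E) ∞ M]
  {g g' : LorentzMetric E M} {p : M}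

/-- A Lorentzian form is positive definite on the orthogonal complement of any timelike vector. -/
theorem LorentzMetric.pos_of_orthogonal (g : LorentzMetric E M)
    {t w : TangentSpace 𝓘(ℝ, E) p} (ht : g.val p t t < 0) (h : g.val p t w = 0) (hw : w ≠ 0) :
    0 < g.val p w w := by
  obtain ⟨v, -, hpos⟩ := g.lorentzian p
  by_contra! hle
  set a := g.val p v w with ha
  set b := g.val p v t with hb
  -- The span of `t` and `w` would be negative semidefinite, yet it contains a vector orthogonal to
  -- `v`, where the form is positive.
  have hu : g.val p v (a • t - b • w) = 0 := by
    simp only [map_sub, map_smul, smul_eq_mul, ← ha, ← hb]; ring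
  have hwt : g.val p w t = 0 := by rw [g.symm, h]
  have huu : g.val p (a • t - b • w) (a • t - b • w)
      = a ^ 2 * g.val p t t + b ^ 2 * g.val p w w := by
    simp only [map_sub, map_smul, sub_apply, smul_apply,
      smul_eq_mul, h, hwt]; ring
  by_cases h0 : a • t - b • w = 0
  · have htu : g.val p t (a • t - b • w) = 0 := by rw [h0, map_zero]
    simp only [map_sub, map_smul, smul_eq_mul, h, mul_zero, sub_zero] at htu
    have ha0 : a = 0 := by
      rcases mul_eq_zero.1 htu with h1 | h1
      · exact h1
      · exact absurd h1 ht.ne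
    rw [ha0, zero_smul, zero_sub, neg_eq_zero] at h0
    have hb0 : b = 0 := (smul_eq_zero.1 h0).resolve_right hw
    have ht0 : t ≠ 0 := by rintro rfl; simp at ht
    exact absurd (hpos t (hb ▸ hb0) ht0) ht.not_gt
  · have := hpos _ hu h0
    rw [huu] at this
    nlinarith [mul_nonneg (sq_nonneg a) (neg_nonneg.2 ht.le),
      mul_nonneg (sq_nonneg b) (neg_nonneg.2 hle)]

/-- A causal vector is never orthogonal to the timelike field, so the weak inequality is already
strict. Future causality thus becomes a closed condition on nonzero vectors, as the compactness
arguments need. -/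
theorem isFutureCausal_of_nonpos (T : TimeOrientation g) {v : TangentSpace 𝓘(ℝ, E) p}
    (hv : v ≠ 0) (h1 : g.val p v v ≤ 0) (h2 : g.val p v (T.field p) ≤ 0) :
    IsFutureCausal g T v := by
  refine ⟨⟨hv, h1⟩, lt_of_le_of_ne h2 fun h0 ↦ ?_⟩
  exact absurd (g.pos_of_orthogonal (T.timelike p) (by rw [g.symm, h0]) hv) h1.not_gt

/-- If `v` pointed to the `g'`-past or were `g'`-orthogonal to the field `t`, then `b • t - a • v`
would be `g`-causal, hence `g'`-timelike, while being `g'`-orthogonal to the timelike `t`. -/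
theorem IsFutureCausal.widen {T : TimeOrientation g} {v : TangentSpace 𝓘(ℝ, E) p}
    (hv : IsFutureCausal g T v) (hg : Wider g g') :
    g'.val p v v < 0 ∧ g'.val p v (T.field p) < 0 := by
  refine ⟨hg p v hv.1, ?_⟩
  by_contra! hb
  have hT := T.timelike p
  have hT' := hg p _ hT.isCausal
  unfold IsTimelike at hT hT'
  obtain ⟨⟨-, hvv⟩, hvT⟩ := hv
  have hTv : g.val p (T.field p) v < 0 := by rwa [g.symm]
  set t := T.field p
  set a := g'.val p t t with ha
  set b := g'.val p v t with hb'
  have hwT : g.val p (b • t - a • v) t < 0 := by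
    simp only [map_sub, map_smul, sub_apply, smul_apply,
      smul_eq_mul]
    nlinarith [mul_nonneg hb (neg_nonneg.2 hT.le), mul_pos_of_neg_of_neg hT' hvT]
  have hw0 : b • t - a • v ≠ 0 := by
    intro h0; rw [h0] at hwT; simp at hwT
  have hww : g.val p (b • t - a • v) (b • t - a • v) ≤ 0 := by
    simp only [map_sub, map_smul, sub_apply, smul_apply,
      smul_eq_mul]
    nlinarith [mul_nonneg (sq_nonneg b) (neg_nonneg.2 hT.le),
      mul_nonneg (sq_nonneg a) (neg_nonneg.2 hvv),
      mul_nonneg (mul_nonneg hb (neg_nonneg.2 hT'.le)) (neg_nonneg.2 hTv.le),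
      mul_nonneg (mul_nonneg hb (neg_nonneg.2 hT'.le)) (neg_nonneg.2 hvT.le)]
  have h1 : g'.val p _ _ < 0 := hg p _ ⟨hw0, hww⟩
  refine absurd (g'.pos_of_orthogonal hT' ?_ hw0) h1.not_gt
  have : g'.val p t v = b := by rw [g'.symm]
  simp only [map_sub, map_smul, smul_eq_mul, this, ← ha]
  ring

/-- A covector which is positive on the future causal cone has a timelike gradient. -/
theorem exists_timelike_gradient [FiniteDimensional ℝ E] (T : TimeOrientation g)
    (L : TangentSpace 𝓘(ℝ, E) p →ₗ[ℝ] ℝ) (hL : ∀ v, IsFutureCausal g T v → 0 < L v) :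
    ∃ u : TangentSpace 𝓘(ℝ, E) p, (∀ w, g.val p u w = L w) ∧ IsTimelike g u := by
  have : FiniteDimensional ℝ (TangentSpace 𝓘(ℝ, E) p) := inferInstanceAs (FiniteDimensional ℝ E)
  have hT : g.val p (T.field p) (T.field p) < 0 := T.timelike p
  set t := T.field p with ht
  let Φ : TangentSpace 𝓘(ℝ, E) p →ₗ[ℝ] (Module.Dual ℝ (TangentSpace 𝓘(ℝ, E) p)) :=
    { toFun := fun v ↦ (g.val p v).toLinearMap
      map_add' := fun v w ↦ by ext; simp
      map_smul' := fun c w ↦ by ext; simp }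
  have hinj : Function.Injective Φ := by
    rw [injective_iff_map_eq_zero]
    intro v hv
    by_contra hv0
    have hz : ∀ w, g.val p v w = 0 := fun w ↦ LinearMap.congr_fun hv w
    exact (g.pos_of_orthogonal hT (by rw [g.symm, hz]) hv0).ne' (hz v)
  obtain ⟨u, hu⟩ := (LinearMap.injective_iff_surjective_of_finrank_eq_finrank
    (Subspace.dual_finrank_eq).symm).1 hinj L
  have hu' : ∀ w, g.val p u w = L w := fun w ↦ LinearMap.congr_fun hu w
  refine ⟨u, hu', ?_⟩
  by_contra hn
  have hn : 0 ≤ g.val p u u := not_lt.1 hn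
  have hut : 0 < g.val p u t := by
    rw [hu']
    exact hL _ (isFutureCausal_of_nonpos T (T.timelike p).isCausal.1 hT.le hT.le)
  -- `u = a • t + w` with `w` orthogonal to `t`
  set k := g.val p t t with hk
  set a := g.val p u t / k with ha
  have hak : a * k = g.val p u t := div_mul_cancel₀ _ hT.ne
  have ha0 : a < 0 := div_neg_of_pos_of_neg hut hT
  set w := u - a • t with hw
  have htu : g.val p t u = a * k := by rw [g.symm, hak]
  have htw : g.val p t w = 0 := by
    rw [hw, map_sub, map_smul, htu, smul_eq_mul]; ring
  have hwt : g.val p w t = 0 := by rw [g.symm, htw]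
  have hu_eq : u = a • t + w := by rw [hw]; abel
  have huu : g.val p u u = a ^ 2 * k + g.val p w w := by
    rw [hu_eq]
    simp only [map_add, map_smul, add_apply, smul_apply,
      smul_eq_mul, htw, hwt, ← hk]
    ring
  set n := g.val p w w with hn'
  have hak2 : 0 < -(a ^ 2 * k) := by nlinarith [mul_pos_of_neg_of_neg ha0 ha0]
  have hnpos : 0 < n := by linarith
  -- Chosen so that `t + l • w` is orthogonal to `u`. It is causal because `n + a ^ 2 * k`, the
  -- square of `u`, is nonnegative, so `L` would vanish on a future causal vector.
  set l := -(a * k) / n with hl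
  have hln : l * n = -(a * k) := div_mul_cancel₀ _ hnpos.ne'
  have hv1 : g.val p (t + l • w) (t + l • w) ≤ 0 := by
    have : g.val p (t + l • w) (t + l • w) = k + l * (l * n) := by
      simp only [map_add, map_smul, add_apply, smul_apply,
        smul_eq_mul, htw, hwt, ← hk, ← hn']
      ring
    rw [this, hln, hl]
    have : k + -(a * k) / n * -(a * k) = k * (n + a ^ 2 * k) / n := by field_simp
    rw [this]
    exact div_nonpos_of_nonpos_of_nonneg (mul_nonpos_of_nonpos_of_nonneg hT.le (by linarith))
      hnpos.le
  have hv2 : g.val p (t + l • w) t < 0 := by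
    simpa only [map_add, map_smul, add_apply, smul_apply,
        smul_eq_mul, hwt, mul_zero, add_zero] using hT
  have hv0 : t + l • w ≠ 0 := by
    intro h0; rw [h0] at hv2; simp at hv2
  have := hL _ (isFutureCausal_of_nonpos T hv0 hv1 hv2.le)
  rw [← hu', hu_eq] at this
  simp only [map_add, map_smul, add_apply, smul_apply,
    smul_eq_mul, htw, hwt, ← hk, ← hn'] at this
  linarith

end LinearAlgebra

end Spacetime

namespace Spacetime

/-! ### Coordinate frames and directional derivatives -/

section Frames

variable {E : Type*} [NormedAddCommGroup E] [NormedSpace ℝ E]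
  {M : Type*} [TopologicalSpace M] [ChartedSpace E M] [IsManifold 𝓘(ℝ, E) ∞ M]

/-- The coordinate frame at `x` of the chart centred at `p`. -/
noncomputable def frame (p x : M) : E →L[ℝ] TangentSpace 𝓘(ℝ, E) x :=
  (trivializationAt E (TangentSpace 𝓘(ℝ, E)) p).symmL ℝ x

theorem exists_frame_eq {p x : M} (hx : x ∈ (chartAt E p).source) (v : TangentSpace 𝓘(ℝ, E) x) :
    ∃ w : E, frame p x w = v :=
  ⟨_, (trivializationAt E (TangentSpace 𝓘(ℝ, E)) p).symmL_continuousLinearMapAt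
    (by simpa using hx) v⟩

theorem frame_ne_zero {p x : M} (hx : x ∈ (chartAt E p).source) {w : E} (hw : w ≠ 0) :
    frame p x w ≠ 0 := by
  intro h0
  apply hw
  have := (trivializationAt E (TangentSpace 𝓘(ℝ, E)) p).continuousLinearMapAt_symmL (R := ℝ)
    (b := x) (by simpa using hx) w
  rw [← this]
  erw [h0]
  exact map_zero _

theorem continuousAt_frame {p x : M} (hx : x ∈ (chartAt E p).source) (w : E) :
    ContinuousAt (fun z : M × E ↦ (⟨z.1, frame p z.1 z.2⟩ : TangentBundle 𝓘(ℝ, E) M)) (x, w) := by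
  have h := (trivializationAt E (TangentSpace 𝓘(ℝ, E)) p).continuousOn_symm
  have hmem : (trivializationAt E (TangentSpace 𝓘(ℝ, E)) p).baseSet ×ˢ univ ∈ 𝓝 (x, w) :=
    ((Trivialization.open_baseSet _).prod isOpen_univ).mem_nhds ⟨by simpa using hx, mem_univ _⟩
  refine (h.continuousAt hmem).congr ?_
  filter_upwards [hmem] with z hz
  have := (trivializationAt E (TangentSpace 𝓘(ℝ, E)) p).symmL_apply (R := ℝ) hz.1 z.2
  exact congrArg (TotalSpace.mk z.1) this.symm

theorem mdifferentiableAt_chartAt_symm {p : M} {z : E} (hz : z ∈ (chartAt E p).target) :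
    MDifferentiableAt 𝓘(ℝ, E) 𝓘(ℝ, E) (chartAt E p).symm z := by
  have h1 : MDifferentiableWithinAt 𝓘(ℝ, E) 𝓘(ℝ, E) (extChartAt 𝓘(ℝ, E) p).symm
      (range 𝓘(ℝ, E)) z :=
    mdifferentiableWithinAt_extChartAt_symm (by simpa using hz)
  simpa [mdifferentiableWithinAt_univ] using! h1

theorem mfderiv_chartAt_symm_apply {p : M} {z : E} (hz : z ∈ (chartAt E p).target) (w : E) :
    mfderiv 𝓘(ℝ, E) 𝓘(ℝ, E) (chartAt E p).symm z w = frame p ((chartAt E p).symm z) w := by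
  have h3 := TangentBundle.symmL_trivializationAt (I := 𝓘(ℝ, E)) ((chartAt E p).map_target hz)
  have h4 : extChartAt 𝓘(ℝ, E) p ((chartAt E p).symm z) = z := by
    simpa using (chartAt E p).right_inv hz
  rw [h4, modelWithCornersSelf_coe, range_id, mfderivWithin_univ] at h3
  exact (DFunLike.congr_fun h3 w).symm

theorem hasVelocityAt_chartAt_symm {p : M} {β : ℝ → E} {β' : E} {t : ℝ} (hβ : HasDerivAt β β' t)
    (ht : β t ∈ (chartAt E p).target) :
    HasVelocityAt (fun s ↦ (chartAt E p).symm (β s)) t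
      (frame p ((chartAt E p).symm (β t)) β') := by
  have h1 := (mdifferentiableAt_chartAt_symm ht).hasMFDerivAt.comp t
    hβ.hasFDerivAt.hasMFDerivAt
  rw [← mfderiv_chartAt_symm_apply ht]
  unfold HasVelocityAt
  refine h1.congr_mfderiv ?_
  refine ContinuousLinearMap.ext fun s ↦ ?_
  exact (mfderiv 𝓘(ℝ, E) 𝓘(ℝ, E) (chartAt E p).symm (β t)).map_smul (show ℝ from s)
    (show TangentSpace 𝓘(ℝ, E) (β t) from β')

/-- The derivative of the function `f` at `x` in the direction of the tangent vector `v`. -/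
noncomputable def dirDeriv (f : M → ℝ) (x : M) (v : TangentSpace 𝓘(ℝ, E) x) : ℝ :=
  mfderiv 𝓘(ℝ, E) 𝓘(ℝ, ℝ) f x v

omit [IsManifold 𝓘(ℝ, E) ∞ M] in
theorem dirDeriv_zero (f : M → ℝ) (x : M) : dirDeriv f x (0 : TangentSpace 𝓘(ℝ, E) x) = 0 :=
  (mfderiv 𝓘(ℝ, E) 𝓘(ℝ, ℝ) f x).map_zero

omit [IsManifold 𝓘(ℝ, E) ∞ M] in
theorem dirDeriv_smul (f : M → ℝ) (x : M) (t : ℝ) (v : TangentSpace 𝓘(ℝ, E) x) :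
    dirDeriv f x (t • v) = t * dirDeriv f x v :=
  (mfderiv 𝓘(ℝ, E) 𝓘(ℝ, ℝ) f x).map_smul t v

omit [IsManifold 𝓘(ℝ, E) ∞ M] in
theorem HasVelocityAt.hasDerivAt_comp {γ : ℝ → M} {t : ℝ} {v : TangentSpace 𝓘(ℝ, E) (γ t)}
    (hγ : HasVelocityAt γ t v) {f : M → ℝ} (hf : MDifferentiableAt 𝓘(ℝ, E) 𝓘(ℝ, ℝ) f (γ t)) :
    HasDerivAt (fun s ↦ f (γ s)) (dirDeriv f (γ t) v) t := by
  have h1 : HasMFDerivAt 𝓘(ℝ, ℝ) 𝓘(ℝ, ℝ) (fun s ↦ f (γ s)) t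
      ((1 : ℝ →L[ℝ] ℝ).smulRight (dirDeriv f (γ t) v)) := by
    refine (hf.hasMFDerivAt.comp t hγ).congr_mfderiv ?_
    refine ContinuousLinearMap.ext fun s ↦ ?_
    exact (mfderiv 𝓘(ℝ, E) 𝓘(ℝ, ℝ) f (γ t)).map_smul (show ℝ from s) v
  have h2 : HasFDerivAt (fun s ↦ f (γ s)) ((1 : ℝ →L[ℝ] ℝ).smulRight
    (dirDeriv f (γ t) v)) t := hasMFDerivAt_iff_hasFDerivAt.1 h1
  exact h2.hasDerivAt.congr_deriv (one_smul ℝ _)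

/-- Continuity is joint in the base point and the coordinate vector, so that strict inequalities
spread uniformly over the compact unit sphere. -/
theorem continuousAt_bilin_frame
    {b : ∀ x : M, TangentSpace 𝓘(ℝ, E) x →L[ℝ] TangentSpace 𝓘(ℝ, E) x →L[ℝ] ℝ}
    (hb : Continuous (fun p : M ↦ TotalSpace.mk' (E →L[ℝ] E →L[ℝ] ℝ)
      (E := fun p : M ↦ TangentSpace 𝓘(ℝ, E) p →L[ℝ] TangentSpace 𝓘(ℝ, E) p →L[ℝ] ℝ) p (b p)))
    {p x : M} (hx : x ∈ (chartAt E p).source) (w : E) :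
    ContinuousAt (fun z : M × E ↦ b z.1 (frame p z.1 z.2) (frame p z.1 z.2)) (x, w) := by
  have h := ContinuousAt.clm_bundle_apply₂ (F₁ := E) (F₂ := E) (F₃ := ℝ)
    (E₃ := Bundle.Trivial M ℝ) (b := fun z : M × E ↦ z.1) (x := (x, w))
    (ψ := fun z : M × E ↦ b z.1) (v := fun z ↦ frame p z.1 z.2) (w := fun z ↦ frame p z.1 z.2)
    (ContinuousAt.comp (x := (x, w)) (f := Prod.fst) hb.continuousAt continuousAt_fst)
    (continuousAt_frame hx w) (continuousAt_frame hx w)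
  exact (Bundle.Trivial.homeomorphProd M ℝ).continuous.continuousAt.comp h |>.snd

theorem continuousAt_bilin_frame_field
    {b : ∀ x : M, TangentSpace 𝓘(ℝ, E) x →L[ℝ] TangentSpace 𝓘(ℝ, E) x →L[ℝ] ℝ}
    (hb : Continuous (fun p : M ↦ TotalSpace.mk' (E →L[ℝ] E →L[ℝ] ℝ)
      (E := fun p : M ↦ TangentSpace 𝓘(ℝ, E) p →L[ℝ] TangentSpace 𝓘(ℝ, E) p →L[ℝ] ℝ) p (b p)))
    {X : ∀ x : M, TangentSpace 𝓘(ℝ, E) x}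
    (hX : Continuous (fun p : M ↦ (⟨p, X p⟩ : TangentBundle 𝓘(ℝ, E) M)))
    {p x : M} (hx : x ∈ (chartAt E p).source) (w : E) :
    ContinuousAt (fun z : M × E ↦ b z.1 (frame p z.1 z.2) (X z.1)) (x, w) := by
  have h := ContinuousAt.clm_bundle_apply₂ (F₁ := E) (F₂ := E) (F₃ := ℝ)
    (E₃ := Bundle.Trivial M ℝ) (b := fun z : M × E ↦ z.1) (x := (x, w))
    (ψ := fun z : M × E ↦ b z.1) (v := fun z ↦ frame p z.1 z.2) (w := fun z ↦ X z.1)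
    (ContinuousAt.comp (x := (x, w)) (f := Prod.fst) hb.continuousAt continuousAt_fst)
    (continuousAt_frame hx w)
    (ContinuousAt.comp (x := (x, w)) (f := Prod.fst) hX.continuousAt continuousAt_fst)
  exact (Bundle.Trivial.homeomorphProd M ℝ).continuous.continuousAt.comp h |>.snd

theorem continuousAt_dirDeriv_frame {f : M → ℝ} (hf : ContMDiff 𝓘(ℝ, E) 𝓘(ℝ, ℝ) ∞ f)
    {p x : M} (hx : x ∈ (chartAt E p).source) (w : E) :
    ContinuousAt (fun z : M × E ↦ dirDeriv f z.1 (frame p z.1 z.2)) (x, w) := by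
  have h1 : Continuous (tangentMap 𝓘(ℝ, E) 𝓘(ℝ, ℝ) f) := hf.continuous_tangentMap (by simp)
  have h2 : Continuous (fun v : TangentBundle 𝓘(ℝ, ℝ) ℝ ↦ (v.2 : ℝ)) :=
    continuous_snd.comp (tangentBundleModelSpaceHomeomorph 𝓘(ℝ, ℝ)).continuous
  exact (h2.comp h1).continuousAt.comp (continuousAt_frame hx w)

end Frames

end Spacetime

/-! ### Monotonicity from almost everywhere positive derivatives -/

theorem lt_of_lipschitzOnWith_of_ae_hasDerivAt_pos {f : ℝ → ℝ} {a b : ℝ} (hab : a < b)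
    {K : NNReal} (hf : LipschitzOnWith K f (Icc a b))
    (hd : ∀ᵐ t : ℝ, t ∈ Icc a b → ∃ d, 0 < d ∧ HasDerivAt f d t) : f a < f b := by
  -- Absolute continuity makes the increment the integral of the derivative, which is positive
  -- almost everywhere.
  have hac : AbsolutelyContinuousOnInterval f a b := by
    apply LipschitzOnWith.absolutelyContinuousOnInterval (K := K)
    rwa [uIcc_of_le hab.le]
  have hpos : ∀ᵐ t : ℝ, t ∈ Icc a b → 0 < deriv f t := by
    filter_upwards [hd] with t ht hmem
    obtain ⟨d, hd0, hd1⟩ := ht hmem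
    rwa [hd1.deriv]
  rw [← sub_pos, ← hac.integral_deriv_eq_sub, intervalIntegral.integral_of_le hab.le]
  have hint := hac.intervalIntegrable_deriv.1
  have hpos' : ∀ᵐ t ∂(volume.restrict (Ioc a b)), 0 < deriv f t := by
    rw [ae_restrict_iff' measurableSet_Ioc]
    filter_upwards [hpos] with t ht hmem using ht (Ioc_subset_Icc_self hmem)
  rw [integral_pos_iff_support_of_nonneg_ae (hpos'.mono fun t ht ↦ ht.le) hint]
  have hsupp : volume.restrict (Ioc a b) (Function.support (deriv f))
      = volume.restrict (Ioc a b) univ := by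
    refine measure_congr ?_
    filter_upwards [hpos'] with t ht
    exact propext ⟨fun _ ↦ trivial, fun _ ↦ ht.ne'⟩
  rw [hsupp, Measure.restrict_apply_univ, Real.volume_Ioc]
  simpa using hab

/-- A function that is locally Lipschitz on an interval and has a positive derivative at almost
every point is strictly increasing. -/
theorem strictMonoOn_of_ae_hasDerivAt_pos {f : ℝ → ℝ} {I : Set ℝ} (hI : I.OrdConnected)
    (hf : ∀ t ∈ I, ∃ K, ∃ U ∈ 𝓝[I] t, LipschitzOnWith K f U)
    (hd : ∀ᵐ t : ℝ, t ∈ I → ∃ d, 0 < d ∧ HasDerivAt f d t) : StrictMonoOn f I := by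
  have hcont : ContinuousOn f I := by
    intro t ht
    obtain ⟨K, U, hU, hK⟩ := hf t ht
    exact (hK.continuousOn t (mem_of_mem_nhdsWithin ht hU)).mono_of_mem_nhdsWithin hU
  -- strict monotonicity to the right of each point
  have hloc : ∀ t ∈ I, ∃ δ > 0, ∀ s ∈ I, t < s → s < t + δ → f t < f s := by
    intro t ht
    obtain ⟨K, U, hU, hK⟩ := hf t ht
    obtain ⟨δ, hδ, hball⟩ := Metric.mem_nhdsWithin_iff.1 hU
    refine ⟨δ, hδ, fun s hs hts hsδ ↦ ?_⟩
    have hsub : Icc t s ⊆ I := hI.out ht hs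
    refine lt_of_lipschitzOnWith_of_ae_hasDerivAt_pos hts (K := K) (hK.mono fun r hr ↦ ?_) ?_
    · refine hball ⟨?_, hsub hr⟩
      rw [Metric.mem_ball, Real.dist_eq, abs_lt]
      constructor <;> linarith [hr.1, hr.2]
    · filter_upwards [hd] with r hr hmem using hr (hsub hmem)
  -- Continuous induction: the closed set where `f x ≤ f t` can always be continued to the right by
  -- `hloc`.
  have hmono : ∀ x ∈ I, ∀ y ∈ I, x ≤ y → f x ≤ f y := by
    intro x hx y hy hxy
    have hsub : Icc x y ⊆ I := hI.out hx hy
    have hclosed : IsClosed ({t | f x ≤ f t} ∩ Icc x y) := by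
      have := (hcont.mono hsub).preimage_isClosed_of_isClosed isClosed_Icc
        (isClosed_Ici (a := f x))
      rwa [inter_comm] at this
    refine hclosed.Icc_subset_of_forall_exists_gt (le_refl (f x)) ?_ ⟨hxy, le_rfl⟩
    rintro t ⟨ht, htI⟩ z hz
    obtain ⟨δ, hδ, h⟩ := hloc t (hsub ⟨htI.1, htI.2.le⟩)
    obtain ⟨s, hs1, hs2⟩ := exists_between (lt_min (lt_min hz htI.2) (by linarith : t < t + δ))
    have hs3 := hs2.trans_le (min_le_left _ _)
    refine ⟨s, le_trans ht (h s (hsub ⟨htI.1.trans hs1.le, (hs3.trans_le (min_le_right _ _)).le⟩)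
      hs1 (hs2.trans_le (min_le_right _ _))).le, hs1, (hs3.trans_le (min_le_left _ _)).le⟩
  intro x hx y hy hxy
  obtain ⟨δ, hδ, h⟩ := hloc x hx
  obtain ⟨s, hs1, hs2⟩ := exists_between (lt_min hxy (by linarith : x < x + δ))
  have hs3 : s < y := hs2.trans_le (min_le_left _ _)
  have hsI : s ∈ I := hI.out hx hy ⟨hs1.le, hs3.le⟩
  exact (h s hsI hs1 (hs2.trans_le (min_le_right _ _))).trans_le (hmono s hsI y hy hs3.le)

namespace Spacetime

/-! ### Criteria for time functions and Cauchy time functions -/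

section TimeFunctions

variable {E : Type*} [NormedAddCommGroup E] [NormedSpace ℝ E]
  {M : Type*} [TopologicalSpace M] [ChartedSpace E M] [IsManifold 𝓘(ℝ, E) ∞ M]
  {g : LorentzMetric E M} {T : TimeOrientation g} {τ τ' : M → ℝ}

theorem IsLocallyLipschitzCurve.exists_lipschitzOnWith_comp {γ : ℝ → M} {I : Set ℝ}
    (hγ : IsLocallyLipschitzCurve E γ I) {f : M → ℝ}
    (hf : ContMDiff 𝓘(ℝ, E) 𝓘(ℝ, ℝ) ∞ f) {t : ℝ} (ht : t ∈ I) :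
    ∃ K, ∃ U ∈ 𝓝[I] t, LipschitzOnWith K (fun s ↦ f (γ s)) U := by
  obtain ⟨K, U, hU, hK⟩ := hγ.2 t ht
  set φ := chartAt E (γ t)
  have hsrc : φ.source ∈ 𝓝 (γ t) := chart_source_mem_nhds E (γ t)
  have hmem : γ t ∈ φ.source := mem_chart_source E (γ t)
  have hsm : ContDiffAt ℝ ∞ (f ∘ φ.symm) (φ (γ t)) := by
    have h1 : ContMDiffAt 𝓘(ℝ, E) 𝓘(ℝ, E) ∞ φ.symm (φ (γ t)) :=
      (contMDiffOn_chart_symm (I := 𝓘(ℝ, E)) (x := γ t)).contMDiffAt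
        (φ.open_target.mem_nhds (φ.map_source hmem))
    exact (hf.contMDiffAt.comp _ h1).contDiffAt
  obtain ⟨K', V, hV, hK'⟩ := (hsm.of_le (by simp : (1 : WithTop ℕ∞) ≤ ∞)).exists_lipschitzOnWith
  have hγt : Tendsto γ (𝓝[I] t) (𝓝 (γ t)) := hγ.1 t ht
  have h1 : γ ⁻¹' φ.source ∈ 𝓝[I] t := hγt hsrc
  have h2 : (fun s ↦ φ (γ s)) ⁻¹' V ∈ 𝓝[I] t :=
    ((φ.continuousAt hmem).tendsto.comp hγt) hV
  refine ⟨K' * K, U ∩ (γ ⁻¹' φ.source ∩ (fun s ↦ φ (γ s)) ⁻¹' V),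
    inter_mem hU (inter_mem h1 h2), ?_⟩
  have h3 : LipschitzOnWith (K' * K) ((f ∘ φ.symm) ∘ fun s ↦ φ (γ s))
      (U ∩ (γ ⁻¹' φ.source ∩ (fun s ↦ φ (γ s)) ⁻¹' V)) :=
    hK'.comp (hK.mono inter_subset_left) fun s hs ↦ hs.2.2
  intro x hx y hy
  have := h3 hx hy
  simpa only [Function.comp_apply, φ.left_inv hx.2.1, φ.left_inv hy.2.1] using this

theorem isTimeFunction_of_dirDeriv_pos (hf : ContMDiff 𝓘(ℝ, E) 𝓘(ℝ, ℝ) ∞ τ)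
    (hpos : ∀ (p : M) (v : TangentSpace 𝓘(ℝ, E) p), IsFutureCausal g T v →
      0 < dirDeriv τ p v) : IsTimeFunction g T τ := by
  refine ⟨hf.continuous, fun γ I hγ ↦ ?_⟩
  refine strictMonoOn_of_ae_hasDerivAt_pos hγ.1
    (fun t ht ↦ hγ.2.1.exists_lipschitzOnWith_comp hf ht) ?_
  filter_upwards [hγ.2.2] with t ht hmem
  obtain ⟨v, hv, hv'⟩ := ht hmem
  exact ⟨_, hpos _ v hv', hv.hasDerivAt_comp (hf.mdifferentiableAt (by simp))⟩

/-- Where `τ` equals `r - c` or `r + c`, the values of `τ'` lie on either side of `r`. The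
intermediate value theorem, on `M` or along the curve, gives existence; strict monotonicity gives
uniqueness. -/
theorem IsCauchyTimeFunction.of_abs_sub_lt [ConnectedSpace M] (hτ : IsCauchyTimeFunction g T τ)
    (hτ' : IsTimeFunction g T τ') {c : ℝ} (hc : ∀ p, |τ' p - τ p| < c) :
    IsCauchyTimeFunction g T τ' := by
  obtain ⟨-, hsurj, hmeet⟩ := hτ
  refine ⟨hτ', fun r ↦ ?_, fun γ I hγ hinext r ↦ ?_⟩
  · obtain ⟨p, hp⟩ := hsurj (r - c)
    obtain ⟨q, hq⟩ := hsurj (r + c)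
    have h1 := abs_lt.1 (hc p)
    have h2 := abs_lt.1 (hc q)
    exact mem_range_of_exists_le_of_exists_ge hτ'.1 ⟨p, by linarith⟩ ⟨q, by linarith⟩
  · obtain ⟨s, ⟨hs, hs'⟩, -⟩ := hmeet γ I hγ hinext (r - c)
    obtain ⟨t, ⟨ht, ht'⟩, -⟩ := hmeet γ I hγ hinext (r + c)
    have h1 := abs_lt.1 (hc (γ s))
    have h2 := abs_lt.1 (hc (γ t))
    have hcont : ContinuousOn (fun t ↦ τ' (γ t)) I := hτ'.1.comp_continuousOn hγ.2.1.1
    obtain ⟨u, hu, hu'⟩ := hγ.1.isPreconnected.intermediate_value hs ht hcont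
      (show r ∈ Icc _ _ from ⟨by linarith, by linarith⟩)
    refine ⟨u, ⟨hu, hu'⟩, fun y hy ↦ ?_⟩
    exact (hτ'.2 γ I hγ).injOn hy.1 hu (hy.2.trans hu'.symm)

end TimeFunctions

end Spacetime

/-! ### Mollification and reparametrisation -/

/-- Mollification of a continuous function on a ball which preserves a lower bound on the
increments in a given cone of directions. -/
theorem exists_contDiff_abs_sub_le_of_le_increment {E : Type*} [NormedAddCommGroup E]
    [NormedSpace ℝ E] [FiniteDimensional ℝ E] {z : E} {r : ℝ} (hr : 0 < r) {f : E → ℝ}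
    (hf : ContinuousOn f (Metric.ball z r)) {Γ : Set E} (hΓ : ∀ v ∈ Γ, ∀ t : ℝ, 0 < t → t • v ∈ Γ)
    {c : ℝ} (hc : ∀ v ∈ Γ, ∀ x ∈ Metric.ball z r, x + v ∈ Metric.ball z r →
      c * ‖v‖ ≤ f (x + v) - f x) {ε : ℝ} (hε : 0 < ε) :
    ∃ F : E → ℝ, ContDiff ℝ ∞ F ∧ (∀ x ∈ Metric.ball z (r / 2), |F x - f x| ≤ ε) ∧
      ∀ x ∈ Metric.ball z (r / 2), ∀ v ∈ Γ, c * ‖v‖ ≤ fderiv ℝ F x v := by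
  let _ : MeasurableSpace E := borel E
  have : BorelSpace E := ⟨rfl⟩
  let μ : Measure E := Measure.addHaar
  set B := Metric.closedBall z (3 * r / 4) with hB
  have hBr : B ⊆ Metric.ball z r := Metric.closedBall_subset_ball (by linarith)
  have hBc : IsCompact B := isCompact_closedBall _ _
  have hfB : ContinuousOn f B := hf.mono hBr
  let f₀ : E → ℝ := B.indicator f
  have hf₀ : Integrable f₀ μ :=
    (integrable_indicator_iff hBc.measurableSet).2 (hfB.integrableOn_compact hBc)
  have hf₀' : ∀ x ∈ B, f₀ x = f x := fun x hx ↦ indicator_of_mem hx f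
  obtain ⟨δ, hδ, huc⟩ := Metric.uniformContinuousOn_iff.1
    (hBc.uniformContinuousOn_of_continuous hfB) ε hε
  -- The bound `r / 4` keeps translates of the half ball inside `B`, where `f₀` agrees with `f`; the
  -- bound `δ` gives the accuracy `ε`.
  set η := min δ (r / 4) with hη
  have hη0 : 0 < η := lt_min hδ (by linarith)
  let ρ : ContDiffBump (0 : E) := ⟨η / 2, η, by linarith, by linarith⟩
  have hmem : ∀ x ∈ Metric.ball z (r / 2), ∀ y, dist y x < η → y ∈ B := by
    intro x hx y hy
    rw [Metric.mem_ball] at hx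
    rw [hB, Metric.mem_closedBall]
    have := dist_triangle y x z
    have := min_le_right δ (r / 4)
    linarith
  set F : E → ℝ := convolution (ρ.normed μ) f₀ (ContinuousLinearMap.lsmul ℝ ℝ) μ with hF
  have hFs : ContDiff ℝ ∞ F := ρ.hasCompactSupport_normed.contDiff_convolution_left _
    ρ.contDiff_normed hf₀.locallyIntegrable
  have hint : ∀ x, Integrable (fun t ↦ ρ.normed μ t * f₀ (x - t)) μ := fun x ↦
    ρ.hasCompactSupport_normed.convolutionExists_left (ContinuousLinearMap.lsmul ℝ ℝ)
      ρ.continuous_normed hf₀.locallyIntegrable x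
  have hFx : ∀ x, F x = ∫ t, ρ.normed μ t * f₀ (x - t) ∂μ := fun x ↦ rfl
  have hsupp : ∀ t, ρ.normed μ t ≠ 0 → ‖t‖ < η := by
    intro t ht
    have : t ∈ Function.support (ρ.normed μ) := ht
    rw [ρ.support_normed_eq] at this
    simpa using this
  refine ⟨F, hFs, fun x hx ↦ ?_, fun x hx v hv ↦ ?_⟩
  · have hxB : x ∈ B := hmem x hx x (by simpa using hη0)
    rw [← hf₀' x hxB, ← Real.dist_eq]
    refine ρ.dist_normed_convolution_le hf₀.aestronglyMeasurable fun y hy ↦ ?_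
    have hy' : dist y x < η := hy
    have hyB := hmem x hx y hy'
    rw [hf₀' x hxB, hf₀' y hyB]
    exact (huc y hyB x hxB (hy'.trans_le (min_le_left _ _))).le
  · have hline : HasDerivAt (fun s : ℝ ↦ x + s • v) v 0 := by
      simpa using ((hasDerivAt_id (0 : ℝ)).smul_const v).const_add x
    have hder : HasDerivAt (fun s : ℝ ↦ F (x + s • v)) (fderiv ℝ F x v) 0 := by
      have h1 : HasFDerivAt F (fderiv ℝ F x) (x + (0 : ℝ) • v) := by
        simpa using (hFs.differentiable (by simp) x).hasFDerivAt
      exact h1.comp_hasDerivAt (0 : ℝ) hline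
    refine ge_of_tendsto hder.tendsto_slope_zero_right ?_
    have hev : ∀ᶠ s : ℝ in 𝓝[>] 0, x + s • v ∈ Metric.ball z (r / 2) := by
      have : Tendsto (fun s : ℝ ↦ x + s • v) (𝓝 0) (𝓝 x) := by
        simpa using hline.continuousAt.tendsto
      exact nhdsWithin_le_nhds (this (Metric.isOpen_ball.mem_nhds hx))
    filter_upwards [hev, self_mem_nhdsWithin] with s hs hs0
    have hs0 : 0 < s := hs0
    -- The increment of `F` is an average of increments of `f` between translated endpoints, each
    -- obeying the same bound.
    have key : s * (c * ‖v‖) ≤ F (x + s • v) - F x := by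
      rw [hFx, hFx, ← integral_sub (hint _) (hint _)]
      have h1 : s * (c * ‖v‖) = ∫ t, ρ.normed μ t * (s * (c * ‖v‖)) ∂μ := by
        rw [integral_mul_const, ρ.integral_normed, one_mul]
      rw [h1]
      refine integral_mono (ρ.integrable_normed.mul_const _) ((hint _).sub (hint _)) fun t ↦ ?_
      by_cases ht : ρ.normed μ t = 0
      · simp [ht]
      have htη := hsupp t ht
      have hd : ∀ y : E, dist (y - t) y < η := fun y ↦ by simpa [dist_eq_norm] using htη
      have hm1 := hmem x hx _ (hd x)
      have hm2 := hmem _ hs _ (hd (x + s • v))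
      have h2 := hc (s • v) (hΓ v hv s hs0) (x - t) (hBr hm1)
        (by rw [show x - t + s • v = x + s • v - t by abel]; exact hBr hm2)
      rw [show x - t + s • v = x + s • v - t by abel, norm_smul, Real.norm_of_nonneg hs0.le] at h2
      simp only
      rw [hf₀' _ hm1, hf₀' _ hm2, ← mul_sub]
      exact mul_le_mul_of_nonneg_left (by linarith) (ρ.nonneg_normed t)
    simp only [zero_add, zero_smul, add_zero, smul_eq_mul]
    rw [inv_mul_eq_div, le_div_iff₀ hs0]
    linarith

/-- Reparametrisation by the primitive of a positive speed. -/
theorem exists_contDiff_reparametrisation {l : ℝ → ℝ} (hl : Continuous l) {c : ℝ} (hc : 0 < c)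
    (hcl : ∀ s, c ≤ l s) :
    ∃ (σ : ℝ → ℝ) (b : ℝ), c ≤ b ∧ σ 0 = 0 ∧ σ b = 1 ∧ Monotone σ ∧ ContDiff ℝ 1 σ ∧
      ∀ s, HasDerivAt σ (l (σ s))⁻¹ s := by
  set L : ℝ → ℝ := fun t ↦ ∫ s in (0 : ℝ)..t, l s with hL
  have hlpos : ∀ s, 0 < l s := fun s ↦ hc.trans_le (hcl s)
  have hder : ∀ t, HasDerivAt L (l t) t := fun t ↦
    intervalIntegral.integral_hasDerivAt_right (hl.intervalIntegrable _ _)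
      (hl.stronglyMeasurableAtFilter _ _) hl.continuousAt
  have hmono : StrictMono L := strictMono_of_hasDerivAt_pos hder hlpos
  have hLc : Continuous L := continuous_iff_continuousAt.2 fun t ↦ (hder t).continuousAt
  have hL0 : L 0 = 0 := by simp [hL]
  -- Growth at least linear makes `L` onto, so its inverse `σ` is defined on all of `ℝ`.
  have hincr : Monotone (fun t ↦ L t - c * t) := by
    refine monotone_of_hasDerivAt_nonneg (f' := fun t ↦ l t - c) (fun t ↦ ?_)
      fun t ↦ sub_nonneg.2 (hcl t)
    exact (hder t).sub (((hasDerivAt_id t).const_mul c).congr_deriv (mul_one c))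
  have hge : ∀ t, 0 ≤ t → c * t ≤ L t := fun t ht ↦ by
    have := hincr ht
    simp only [hL0] at this
    linarith
  have hle : ∀ t, t ≤ 0 → L t ≤ c * t := fun t ht ↦ by
    have := hincr ht
    simp only [hL0] at this
    linarith
  have hsurj : Function.Surjective L := by
    refine hLc.surjective ?_ ?_
    · refine tendsto_atTop_mono' _ ?_ (tendsto_id.const_mul_atTop hc)
      filter_upwards [eventually_ge_atTop 0] with t ht using hge t ht
    · refine tendsto_atBot_mono' _ ?_ (tendsto_id.const_mul_atBot hc)
      filter_upwards [eventually_le_atBot 0] with t ht using hle t ht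
  let e := StrictMono.orderIsoOfSurjective L hmono hsurj
  have heL : ∀ t, e.symm (L t) = t := fun t ↦ e.symm_apply_apply t
  have hLe : ∀ s, L (e.symm s) = s := fun s ↦ e.apply_symm_apply s
  have hσ : ∀ s, HasDerivAt e.symm (l (e.symm s))⁻¹ s := fun s ↦
    (hder _).of_local_left_inverse e.symm.continuous.continuousAt (hlpos _).ne'
      (Eventually.of_forall hLe)
  refine ⟨e.symm, L 1, by simpa using hge 1 zero_le_one, by simpa only [hL0] using heL 0, heL 1,
    e.symm.monotone, ?_, hσ⟩
  rw [contDiff_one_iff_deriv]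
  refine ⟨fun s ↦ (hσ s).differentiableAt, ?_⟩
  rw [show deriv e.symm = fun s ↦ (l (e.symm s))⁻¹ from funext fun s ↦ (hσ s).deriv]
  exact (hl.comp e.symm.continuous).inv₀ fun s ↦ (hlpos _).ne'

namespace Spacetime

/-! ### Uniform estimates near a point -/

section LocalEstimates

variable {E : Type*} [NormedAddCommGroup E] [NormedSpace ℝ E]
  {M : Type*} [TopologicalSpace M] [ChartedSpace E M] [IsManifold 𝓘(ℝ, E) ∞ M]
  {g g' : LorentzMetric E M}

/-- The length of a tangent vector for the Riemannian metric `h`. -/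
noncomputable def hnorm (h : SmoothRiemannianMetric E M) {x : M} (v : TangentSpace 𝓘(ℝ, E) x) :
    ℝ :=
  √(h.inner x v v)

theorem hnorm_pos (h : SmoothRiemannianMetric E M) {x : M} {v : TangentSpace 𝓘(ℝ, E) x}
    (hv : v ≠ 0) : 0 < hnorm h v :=
  Real.sqrt_pos.2 (h.pos x v hv)

theorem hnorm_smul (h : SmoothRiemannianMetric E M) {x : M} (v : TangentSpace 𝓘(ℝ, E) x)
    {t : ℝ} (ht : 0 ≤ t) : hnorm h (t • v) = t * hnorm h v := by
  unfold hnorm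
  have : h.inner x (t • v) (t • v) = t ^ 2 * h.inner x v v := by
    simp only [map_smul, smul_apply, smul_eq_mul]; ring
  rw [this, Real.sqrt_mul (sq_nonneg t), Real.sqrt_sq ht]

theorem IsFutureCausal.smul {T : TimeOrientation g} {x : M} {v : TangentSpace 𝓘(ℝ, E) x}
    (hv : IsFutureCausal g T v) {t : ℝ} (ht : 0 < t) : IsFutureCausal g T (t • v) := by
  obtain ⟨⟨h0, h1⟩, h2⟩ := hv
  refine ⟨⟨smul_ne_zero ht.ne' h0, ?_⟩, ?_⟩
  · simp only [map_smul, smul_apply, smul_eq_mul]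
    nlinarith [mul_nonneg (mul_nonneg ht.le ht.le) (neg_nonneg.2 h1)]
  · simp only [map_smul, smul_apply, smul_eq_mul]
    exact mul_neg_of_pos_of_neg ht h2

theorem continuousAt_hnorm_frame (h : SmoothRiemannianMetric E M) {p x : M}
    (hx : x ∈ (chartAt E p).source) (w : E) :
    ContinuousAt (fun z : M × E ↦ hnorm h (frame p z.1 z.2)) (x, w) :=
  (continuousAt_bilin_frame h.contMDiff.continuous hx w).sqrt

/-- By scaling, unit vectors suffice. At `p` such a vector either strictly violates a `g`-condition,
which persists for the first point, or is `g`-causal and so strictly inside the `g'`-cone, which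
persists for the second. Compactness of the sphere makes the neighbourhood uniform. -/
theorem eventually_frame_isFutureCausal [FiniteDimensional ℝ E] (hg : Wider g g')
    (T : TimeOrientation g) (p : M) :
    ∀ᶠ z : M × M in 𝓝 (p, p), ∀ w : E, IsFutureCausal g T (frame p z.1 w) →
      IsFutureCausal g' (T.widen hg) (frame p z.2 w) := by
  have hp := mem_chart_source E p
  have key : ∀ᶠ z : M × M in 𝓝 (p, p), ∀ w ∈ Metric.sphere (0 : E) 1,
      IsFutureCausal g T (frame p z.1 w) → IsFutureCausal g' (T.widen hg) (frame p z.2 w) := by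
    refine (isCompact_sphere (0 : E) 1).eventually_forall_of_forall_eventually fun w hw ↦ ?_
    have hw0 : w ≠ 0 := by rintro rfl; simp at hw
    have t1 : Tendsto (fun z : (M × M) × E ↦ (z.1.1, z.2)) (𝓝 ((p, p), w)) (𝓝 (p, w)) :=
      Continuous.tendsto (by fun_prop) _
    have t2 : Tendsto (fun z : (M × M) × E ↦ (z.1.2, z.2)) (𝓝 ((p, p), w)) (𝓝 (p, w)) :=
      Continuous.tendsto (by fun_prop) _
    have c1 := (continuousAt_bilin_frame g.continuous hp w).tendsto.comp t1
    have c2 := (continuousAt_bilin_frame_field g.continuous T.continuous hp w).tendsto.comp t1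
    have c3 := (continuousAt_bilin_frame g'.continuous hp w).tendsto.comp t2
    have c4 := (continuousAt_bilin_frame_field g'.continuous T.continuous hp w).tendsto.comp t2
    by_cases h1 : 0 < g.val p (frame p p w) (frame p p w)
    · filter_upwards [c1.eventually (lt_mem_nhds h1)] with z hz hcaus
      exact absurd hcaus.1.2 (not_le.2 hz)
    by_cases h2 : 0 < g.val p (frame p p w) (T.field p)
    · filter_upwards [c2.eventually (lt_mem_nhds h2)] with z hz hcaus
      exact absurd hcaus.2.le (not_le.2 hz)
    have h3 := (isFutureCausal_of_nonpos T (frame_ne_zero hp hw0) (not_lt.1 h1)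
      (not_lt.1 h2)).widen hg
    filter_upwards [c3.eventually (gt_mem_nhds h3.1), c4.eventually (gt_mem_nhds h3.2)]
      with z hz1 hz2 _
    exact ⟨IsTimelike.isCausal hz1, hz2⟩
  filter_upwards [key] with z hz w hw
  have hw0 : w ≠ 0 := by
    rintro rfl
    exact hw.1.1 (map_zero _)
  have hn : 0 < ‖w‖ := norm_pos_iff.2 hw0
  have h1 := hz (‖w‖⁻¹ • w) (by simp [norm_smul, hn.ne'])
    (by rw [map_smul]; exact hw.smul (inv_pos.2 hn))
  have h2 := h1.smul hn
  rwa [map_smul, smul_smul, mul_inv_cancel₀ hn.ne', one_smul] at h2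

theorem eventually_hnorm_frame [FiniteDimensional ℝ E] (h : SmoothRiemannianMetric E M) (p : M) :
    ∃ c C : ℝ, 0 < c ∧ 0 < C ∧ ∀ᶠ x in 𝓝 p, ∀ w : E,
      c * ‖w‖ ≤ hnorm h (frame p x w) ∧ hnorm h (frame p x w) ≤ C * ‖w‖ := by
  have hp := mem_chart_source E p
  have hcont : ContinuousOn (fun w ↦ hnorm h (frame p p w)) (Metric.sphere (0 : E) 1) := fun w _ ↦
    ContinuousAt.continuousWithinAt
      (ContinuousAt.comp (f := fun w : E ↦ (p, w)) (continuousAt_hnorm_frame h hp w) (by fun_prop))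
  obtain ⟨c, hc, hc'⟩ := (isCompact_sphere (0 : E) 1).exists_forall_le' hcont (a := 0)
    fun w hw ↦ hnorm_pos h (frame_ne_zero hp (by rintro rfl; simp at hw))
  obtain ⟨C, hC⟩ := (isCompact_sphere (0 : E) 1).exists_bound_of_continuousOn hcont
  refine ⟨c / 2, max C 0 + 1, by positivity, by positivity, ?_⟩
  have key : ∀ᶠ x in 𝓝 p, ∀ w ∈ Metric.sphere (0 : E) 1,
      c / 2 ≤ hnorm h (frame p x w) ∧ hnorm h (frame p x w) ≤ max C 0 + 1 := by
    refine (isCompact_sphere (0 : E) 1).eventually_forall_of_forall_eventually fun w hw ↦ ?_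
    have ht := (continuousAt_hnorm_frame h hp w).tendsto
    have h1 : c / 2 < hnorm h (frame p p w) := by linarith [hc' w hw]
    have h2 : hnorm h (frame p p w) < max C 0 + 1 := by
      linarith [(le_abs_self _).trans (hC w hw), le_max_left C 0]
    filter_upwards [ht.eventually (lt_mem_nhds h1), ht.eventually (gt_mem_nhds h2)] with z a b
    exact ⟨a.le, b.le⟩
  filter_upwards [key] with x hx w
  rcases eq_or_ne w 0 with rfl | hw0
  · simp [hnorm]
  have hn : 0 < ‖w‖ := norm_pos_iff.2 hw0
  have h1 := hx (‖w‖⁻¹ • w) (by simp [norm_smul, hn.ne'])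
  rw [map_smul, hnorm_smul h _ (inv_pos.2 hn).le, inv_mul_eq_div, le_div_iff₀ hn,
    div_le_iff₀ hn] at h1
  exact h1

theorem exists_abs_dirDeriv_le [FiniteDimensional ℝ E] (h : SmoothRiemannianMetric E M)
    {f : M → ℝ} (hf : ContMDiff 𝓘(ℝ, E) 𝓘(ℝ, ℝ) ∞ f) {K : Set M} (hK : IsCompact K) :
    ∃ A : ℝ, 0 ≤ A ∧ ∀ x ∈ K, ∀ v : TangentSpace 𝓘(ℝ, E) x,
      |dirDeriv f x v| ≤ A * hnorm h v := by
  refine hK.induction_on (p := fun s ↦ ∃ A : ℝ, 0 ≤ A ∧ ∀ x ∈ s, ∀ v : TangentSpace 𝓘(ℝ, E) x,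
      |dirDeriv f x v| ≤ A * hnorm h v) ?_ ?_ ?_ ?_
  · exact ⟨0, le_rfl, by simp⟩
  · rintro s t hst ⟨A, hA, hA'⟩
    exact ⟨A, hA, fun x hx ↦ hA' x (hst hx)⟩
  · rintro s t ⟨A, hA, hA'⟩ ⟨B, hB, hB'⟩
    refine ⟨max A B, hA.trans (le_max_left _ _), fun x hx v ↦ ?_⟩
    rcases hx with hx | hx
    · exact (hA' x hx v).trans
        (mul_le_mul_of_nonneg_right (le_max_left _ _) (Real.sqrt_nonneg _))
    · exact (hB' x hx v).trans
        (mul_le_mul_of_nonneg_right (le_max_right _ _) (Real.sqrt_nonneg _))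
  intro p _
  have hp := mem_chart_source E p
  obtain ⟨c, C, hc, -, hev⟩ := eventually_hnorm_frame h p
  have hcont : ContinuousOn (fun w ↦
      dirDeriv f p (frame p p w)) (Metric.sphere (0 : E) 1) :=
    fun w _ ↦ ContinuousAt.continuousWithinAt
      (ContinuousAt.comp (f := fun w : E ↦ (p, w)) (continuousAt_dirDeriv_frame hf hp w)
        (by fun_prop))
  obtain ⟨A, hA⟩ := (isCompact_sphere (0 : E) 1).exists_bound_of_continuousOn hcont
  have key : ∀ᶠ x in 𝓝 p, ∀ w ∈ Metric.sphere (0 : E) 1,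
      |dirDeriv f x (frame p x w)| ≤ max A 0 + 1 := by
    refine (isCompact_sphere (0 : E) 1).eventually_forall_of_forall_eventually fun w hw ↦ ?_
    have ht := (continuousAt_dirDeriv_frame hf hp w).tendsto.abs
    have h2 : |dirDeriv f p (frame p p w)| < max A 0 + 1 := by
      have := hA w hw
      rw [Real.norm_eq_abs] at this
      linarith [le_max_left A 0]
    filter_upwards [ht.eventually (gt_mem_nhds h2)] with z b
    exact b.le
  have hsrc : ∀ᶠ x in 𝓝 p, x ∈ (chartAt E p).source := chart_source_mem_nhds E p
  refine ⟨_, mem_nhdsWithin_of_mem_nhds (hev.and (key.and hsrc)), (max A 0 + 1) / c, by positivity, ?_⟩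
  rintro x ⟨hx1, hx2, hx3⟩ v
  obtain ⟨w, rfl⟩ := exists_frame_eq hx3 v
  rcases eq_or_ne w 0 with rfl | hw0
  · simp [hnorm, dirDeriv_zero]
  have hn : 0 < ‖w‖ := norm_pos_iff.2 hw0
  have h1 := hx2 (‖w‖⁻¹ • w) (by simp [norm_smul, hn.ne'])
  rw [map_smul, dirDeriv_smul, abs_mul, abs_of_pos (inv_pos.2 hn), inv_mul_eq_div, div_le_iff₀ hn] at h1
  refine h1.trans ?_
  rw [div_mul_eq_mul_div, le_div_iff₀ hc, mul_assoc, mul_comm ‖w‖]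
  exact mul_le_mul_of_nonneg_left (hx1 w).1 (by positivity)

end LocalEstimates

end Spacetime

namespace Spacetime

/-! ### Smoothing in a chart -/

section LocalSmoothing

variable {E : Type*} [NormedAddCommGroup E] [NormedSpace ℝ E]
  {M : Type*} [TopologicalSpace M] [ChartedSpace E M] [IsManifold 𝓘(ℝ, E) ∞ M]
  {g g' : LorentzMetric E M}

/-- An anti-Lipschitz function increases at a definite rate along coordinate segments that are
causal. -/
theorem le_sub_of_antiLipschitz_segment {h : SmoothRiemannianMetric E M} {T : TimeOrientation g}
    {τ : M → ℝ} {O : Set M} {C : ℝ} (hC : 0 < C)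
    (hO : ∀ (γ : ℝ → M) (I : Set ℝ), IsFutureCausalCurve g T γ I →
      IsArclengthParametrised h γ I → MapsTo γ I O → ∀ s₁ ∈ I, ∀ s₂ ∈ I, s₁ ≤ s₂ →
        C * (s₂ - s₁) ≤ τ (γ s₂) - τ (γ s₁))
    {p : M} {x v : E} (hx : ∀ s ∈ Icc (0 : ℝ) 1, x + s • v ∈ (chartAt E p).target)
    (hxO : ∀ s ∈ Icc (0 : ℝ) 1, (chartAt E p).symm (x + s • v) ∈ O)
    (hv : ∀ s ∈ Icc (0 : ℝ) 1, IsFutureCausal g T (frame p ((chartAt E p).symm (x + s • v)) v))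
    {c : ℝ} (hc : 0 < c)
    (hcv : ∀ s ∈ Icc (0 : ℝ) 1, c ≤ hnorm h (frame p ((chartAt E p).symm (x + s • v)) v)) :
    C * c ≤ τ ((chartAt E p).symm (x + v)) - τ ((chartAt E p).symm x) := by
  set φ := chartAt E p with hφ
  -- Clamping the parameter to `[0, 1]` extends the speed of the segment to a continuous function on
  -- `ℝ`, still bounded below by `c`.
  set l : ℝ → ℝ := fun s ↦
    hnorm h (frame p (φ.symm (x + (projIcc (0 : ℝ) 1 zero_le_one s : ℝ) • v)) v) with hl
  have hlc : Continuous l := by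
    refine continuous_iff_continuousAt.2 fun s ↦ ?_
    have hs := hx _ (projIcc (0 : ℝ) 1 zero_le_one s).2
    have h1 : ContinuousAt (fun s : ℝ ↦
        (φ.symm (x + (projIcc (0 : ℝ) 1 zero_le_one s : ℝ) • v), v)) s := by
      refine ContinuousAt.prodMk ?_ continuousAt_const
      refine ContinuousAt.comp (f := fun s : ℝ ↦
        x + (projIcc (0 : ℝ) 1 zero_le_one s : ℝ) • v) (φ.continuousAt_symm hs) ?_
      have : Continuous (fun s : ℝ ↦ (projIcc (0 : ℝ) 1 zero_le_one s : ℝ)) :=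
        continuous_subtype_val.comp continuous_projIcc
      fun_prop
    exact ContinuousAt.comp (f := fun s : ℝ ↦
        (φ.symm (x + (projIcc (0 : ℝ) 1 zero_le_one s : ℝ) • v), v))
      (continuousAt_hnorm_frame h (φ.map_target hs) v) h1
  have hlge : ∀ s, c ≤ l s := fun s ↦ hcv _ (projIcc (0 : ℝ) 1 zero_le_one s).2
  have hl' : ∀ s ∈ Icc (0 : ℝ) 1, l s = hnorm h (frame p (φ.symm (x + s • v)) v) := by
    intro s hs
    have : (projIcc (0 : ℝ) 1 zero_le_one s : ℝ) = s := by rw [projIcc_of_mem zero_le_one hs]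
    exact congrArg (fun r : ℝ ↦ hnorm h (frame p (φ.symm (x + r • v)) v)) this
  obtain ⟨σ, b, hcb, hσ0, hσb, hσm, hσd, hσ⟩ := exists_contDiff_reparametrisation hlc hc hlge
  have hmem : ∀ s ∈ Icc 0 b, σ s ∈ Icc (0 : ℝ) 1 := fun s hs ↦
    ⟨hσ0 ▸ hσm hs.1, hσb ▸ hσm hs.2⟩
  set γ : ℝ → M := fun s ↦ φ.symm (x + σ s • v) with hγ
  have hβ : ∀ s, HasDerivAt (fun s ↦ x + σ s • v) ((l (σ s))⁻¹ • v) s := fun s ↦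
    ((hσ s).smul_const v).const_add x
  have hvel : ∀ s ∈ Icc 0 b,
      HasVelocityAt γ s ((l (σ s))⁻¹ • frame p (φ.symm (x + σ s • v)) v) := by
    intro s hs
    have := hasVelocityAt_chartAt_symm (M := M) (p := p) (hβ s) (hx _ (hmem s hs))
    rwa [map_smul] at this
  have hlpos : ∀ s, 0 < l s := fun s ↦ hc.trans_le (hlge s)
  have hcurve : IsFutureCausalCurve g T γ (Icc 0 b) := by
    refine ⟨ordConnected_Icc, ⟨fun s hs ↦ ?_, fun s hs ↦ ?_⟩, Eventually.of_forall fun s hs ↦ ?_⟩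
    · exact (hvel s hs).continuousAt.continuousWithinAt
    · have hs1 := hx _ (hmem s hs)
      have h1 : ContMDiffAt 𝓘(ℝ, E) 𝓘(ℝ, E) ∞ φ.symm (x + σ s • v) :=
        (contMDiffOn_chart_symm (I := 𝓘(ℝ, E)) (x := p)).contMDiffAt
          (φ.open_target.mem_nhds hs1)
      have h2 : ContMDiffAt 𝓘(ℝ, E) 𝓘(ℝ, E) ∞ (chartAt E (γ s)) (φ.symm (x + σ s • v)) :=
        (contMDiffOn_chart (I := 𝓘(ℝ, E)) (x := γ s)).contMDiffAt
          (chart_source_mem_nhds E (γ s))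
      have h3 : ContDiffAt ℝ ∞ (chartAt E (γ s) ∘ φ.symm) (x + σ s • v) :=
        (h2.comp _ h1).contDiffAt
      have h4 : ContDiffAt ℝ 1 (fun s ↦ x + σ s • v) s := by
        have := hσd.contDiffAt (x := s)
        fun_prop
      have h5 : ContDiffAt ℝ 1 ((chartAt E (γ s) ∘ φ.symm) ∘ fun s ↦ x + σ s • v) s :=
        (h3.of_le (by simp)).comp s h4
      obtain ⟨K, U, hU, hK⟩ := h5.exists_lipschitzOnWith
      exact ⟨K, U, mem_nhdsWithin_of_mem_nhds hU, hK⟩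
    · exact ⟨_, hvel s hs, (hv _ (hmem s hs)).smul (inv_pos.2 (hlpos _))⟩
  have harc : IsArclengthParametrised h γ (Icc 0 b) := by
    refine Eventually.of_forall fun s hs ↦ ⟨_, hvel s hs, ?_⟩
    have h1 : l (σ s) ^ 2 = h.inner (γ s) (frame p (φ.symm (x + σ s • v)) v)
        (frame p (φ.symm (x + σ s • v)) v) := by
      rw [hl' _ (hmem s hs), hnorm, Real.sq_sqrt]
      by_contra! hneg
      have := hnorm_pos h (hv _ (hmem s hs)).1.1
      exact this.ne' (Real.sqrt_eq_zero_of_nonpos hneg.le)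
    simp only [map_smul, smul_apply, smul_eq_mul]
    rw [← h1]
    have := (hlpos (σ s)).ne'
    field_simp
  have hb0 : 0 ≤ b := hc.le.trans hcb
  have := hO γ (Icc 0 b) hcurve harc (fun s hs ↦ hxO _ (hmem s hs)) 0 ⟨le_rfl, hb0⟩ b
    ⟨hb0, le_rfl⟩ hb0
  simp only [hγ, hσ0, hσb, zero_smul, add_zero, one_smul, sub_zero] at this
  exact (mul_le_mul_of_nonneg_left hcb hC.le).trans this

theorem dirDeriv_comp_chartAt_frame {p x : M} (hx : x ∈ (chartAt E p).source) {F : E → ℝ}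
    (hF : ContDiff ℝ ∞ F) (w : E) :
    dirDeriv (fun y ↦ F (chartAt E p y)) x (frame p x w) = fderiv ℝ F (chartAt E p x) w := by
  obtain ⟨z, hz, rfl⟩ : ∃ z ∈ (chartAt E p).target, (chartAt E p).symm z = x :=
    ⟨_, (chartAt E p).map_source hx, (chartAt E p).left_inv hx⟩
  rw [(chartAt E p).right_inv hz]
  have hd : MDifferentiableAt 𝓘(ℝ, E) 𝓘(ℝ, ℝ) (fun y ↦ F (chartAt E p y))
      ((chartAt E p).symm z) := by
    refine MDifferentiableAt.comp _ (hF.differentiable (by simp) _).mdifferentiableAt ?_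
    exact ((contMDiffOn_chart (I := 𝓘(ℝ, E)) (x := p) (n := ∞)).contMDiffAt
      ((chartAt E p).open_source.mem_nhds hx)).mdifferentiableAt (by simp)
  unfold dirDeriv
  rw [← mfderiv_chartAt_symm_apply hz]
  have h1 := mfderiv_comp_apply z hd (mdifferentiableAt_chartAt_symm hz) w
  refine h1.symm.trans ?_
  have h2 : (fun y ↦ F (chartAt E p y)) ∘ (chartAt E p).symm =ᶠ[𝓝 z] F := by
    filter_upwards [(chartAt E p).open_target.mem_nhds hz] with y hy
    simp [(chartAt E p).right_inv hy]
  rw [h2.mfderiv_eq, mfderiv_eq_fderiv]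
  rfl

/-- Local approximation of an anti-Lipschitz function by smooth functions increasing at a
definite rate in all causal directions. -/
theorem IsLocallyAntiLipschitz.exists_local_smoothing [FiniteDimensional ℝ E] [T2Space M]
    {h : SmoothRiemannianMetric E M} {T : TimeOrientation g} {hg : Wider g g'} {τ : M → ℝ}
    (hτ : IsLocallyAntiLipschitz h g' (T.widen hg) τ) (hcont : Continuous τ) (p : M) :
    ∃ U : Set M, IsOpen U ∧ p ∈ U ∧ IsCompact (closure U) ∧ ∃ c : ℝ, 0 < c ∧ ∀ ε : ℝ, 0 < ε →
      ∃ F : M → ℝ, (∀ x ∈ U, ContMDiffAt 𝓘(ℝ, E) 𝓘(ℝ, ℝ) ∞ F x) ∧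
        (∀ x ∈ U, |F x - τ x| ≤ ε) ∧
        ∀ x ∈ U, ∀ v : TangentSpace 𝓘(ℝ, E) x, IsFutureCausal g T v →
          c * hnorm h v ≤ dirDeriv F x v := by
  set φ := chartAt E p with hφ
  have hp : p ∈ φ.source := mem_chart_source E p
  obtain ⟨O, hO, -, C, hC, hanti⟩ := hτ p
  obtain ⟨a, A, ha, hA, hnormev⟩ := eventually_hnorm_frame h p
  have hcone := eventually_frame_isFutureCausal hg T p
  rw [nhds_prod_eq] at hcone
  obtain ⟨W, hW, hWW⟩ := mem_prod_self_iff.1 hcone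
  set V := W ∩ (O ∩ {x | ∀ w : E, a * ‖w‖ ≤ hnorm h (frame p x w) ∧
    hnorm h (frame p x w) ≤ A * ‖w‖}) with hV
  have hVn : V ∈ 𝓝 p := inter_mem hW (inter_mem hO hnormev)
  have hpre : φ.target ∩ φ.symm ⁻¹' V ∈ 𝓝 (φ p) := by
    refine inter_mem (φ.open_target.mem_nhds (φ.map_source hp)) ?_
    have := φ.continuousAt_symm (φ.map_source hp)
    rw [ContinuousAt, φ.left_inv hp] at this
    exact this hVn
  obtain ⟨r, hr, hball⟩ := Metric.mem_nhds_iff.1 hpre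
  -- Requiring causality at every point of `W` makes whole coordinate segments causal; by the choice
  -- of `W`, every direction that is `g`-causal at some point of `W` belongs to `Γ`.
  set Γ : Set E := {v | v ≠ 0 ∧ ∀ y ∈ W, IsFutureCausal g' (T.widen hg) (frame p y v)} with hΓ
  have hΓs : ∀ v ∈ Γ, ∀ t : ℝ, 0 < t → t • v ∈ Γ := by
    rintro v ⟨hv0, hv⟩ t ht
    refine ⟨smul_ne_zero ht.ne' hv0, fun y hy ↦ ?_⟩
    rw [map_smul]
    exact (hv y hy).smul ht
  have hincr : ∀ v ∈ Γ, ∀ x ∈ Metric.ball (φ p) r, x + v ∈ Metric.ball (φ p) r →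
      C * a * ‖v‖ ≤ (τ ∘ φ.symm) (x + v) - (τ ∘ φ.symm) x := by
    rintro v ⟨hv0, hv⟩ x hx hxv
    have hseg : ∀ s ∈ Icc (0 : ℝ) 1, x + s • v ∈ Metric.ball (φ p) r := by
      intro s hs
      have := (convex_ball (φ p) r).add_smul_sub_mem hx hxv hs
      simpa using this
    have := le_sub_of_antiLipschitz_segment (h := h) (T := T.widen hg) hC hanti (p := p)
      (x := x) (v := v) (c := a * ‖v‖) (fun s hs ↦ (hball (hseg s hs)).1)
      (fun s hs ↦ (hball (hseg s hs)).2.2.1) (fun s hs ↦ hv _ (hball (hseg s hs)).2.1)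
      (mul_pos ha (norm_pos_iff.2 hv0)) (fun s hs ↦ ((hball (hseg s hs)).2.2.2 v).1)
    rw [mul_assoc]
    exact this
  have hfc : ContinuousOn (τ ∘ φ.symm) (Metric.ball (φ p) r) :=
    hcont.comp_continuousOn (φ.continuousOn_symm.mono fun x hx ↦ (hball hx).1)
  have hball' : Metric.ball (φ p) (r / 2) ⊆ Metric.ball (φ p) r :=
    Metric.ball_subset_ball (by linarith)
  have hcball : Metric.closedBall (φ p) (r / 2) ⊆ φ.target := fun x hx ↦
    (hball (Metric.closedBall_subset_ball (by linarith) hx)).1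
  -- The rate is `C * a` in the norm of `E`; dividing by `A` converts it to `h`-length. It is fixed
  -- before `ε`.
  refine ⟨φ.source ∩ φ ⁻¹' Metric.ball (φ p) (r / 2), φ.isOpen_inter_preimage Metric.isOpen_ball,
    ⟨hp, Metric.mem_ball_self (by positivity)⟩, ?_, C * a / A, by positivity, fun ε hε ↦ ?_⟩
  · have hK : IsCompact (φ.symm '' Metric.closedBall (φ p) (r / 2)) :=
      (isCompact_closedBall _ _).image_of_continuousOn (φ.continuousOn_symm.mono hcball)
    refine hK.of_isClosed_subset isClosed_closure (closure_minimal ?_ hK.isClosed)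
    rintro x ⟨hx, hx'⟩
    exact ⟨φ x, Metric.ball_subset_closedBall hx', φ.left_inv hx⟩
  · obtain ⟨F, hF, hFε, hFd⟩ :=
      exists_contDiff_abs_sub_le_of_le_increment hr hfc hΓs hincr hε
    refine ⟨fun y ↦ F (φ y), fun x hx ↦ ?_, fun x hx ↦ ?_, fun x hx v hv ↦ ?_⟩
    · exact hF.contMDiff.contMDiffAt.comp x ((contMDiffOn_chart (I := 𝓘(ℝ, E)) (x := p)).contMDiffAt
        (φ.open_source.mem_nhds hx.1))
    · simpa [φ.left_inv hx.1] using hFε (φ x) hx.2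
    · obtain ⟨w, rfl⟩ := exists_frame_eq hx.1 v
      have hxV := (hball (hball' hx.2)).2
      simp only [mem_preimage, φ.left_inv hx.1] at hxV
      have hw : w ∈ Γ := by
        refine ⟨?_, fun y hy ↦ hWW (show ((x, y) : M × M) ∈ W ×ˢ W from ⟨hxV.1, hy⟩) w hv⟩
        rintro rfl
        exact hv.1.1 (map_zero _)
      rw [dirDeriv_comp_chartAt_frame hx.1 hF]
      refine le_trans ?_ (hFd (φ x) hx.2 w hw)
      rw [div_mul_eq_mul_div, div_le_iff₀ hA, mul_assoc (C * a), mul_comm ‖w‖]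
      exact mul_le_mul_of_nonneg_left (hxV.2.2 w).2 (by positivity)

end LocalSmoothing

end Spacetime

namespace Spacetime

/-! ### Gluing by a partition of unity -/

section Gluing

variable {E : Type*} [NormedAddCommGroup E] [NormedSpace ℝ E]
  {M : Type*} [TopologicalSpace M] [ChartedSpace E M] [IsManifold 𝓘(ℝ, E) ∞ M]

/-- One curve serves all functions at once, reducing the Leibniz rule below to calculus in one
variable. -/
theorem exists_curve_hasDerivAt_dirDeriv {x : M} (v : TangentSpace 𝓘(ℝ, E) x) :
    ∃ γ : ℝ → M, γ 0 = x ∧ ContinuousAt γ 0 ∧ ∀ f : M → ℝ,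
      MDifferentiableAt 𝓘(ℝ, E) 𝓘(ℝ, ℝ) f x →
        HasDerivAt (fun s ↦ f (γ s)) (dirDeriv f x v) 0 := by
  have hx : x ∈ (chartAt E x).source := mem_chart_source E x
  obtain ⟨w, rfl⟩ := exists_frame_eq hx v
  obtain ⟨z, hz, hzx⟩ : ∃ z ∈ (chartAt E x).target, (chartAt E x).symm z = x :=
    ⟨_, (chartAt E x).map_source hx, (chartAt E x).left_inv hx⟩
  have hb : z + (0 : ℝ) • w = z := by simp
  have hβ : HasDerivAt (fun s : ℝ ↦ z + s • w) w 0 := by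
    simpa using ((hasDerivAt_id (0 : ℝ)).smul_const w).const_add z
  have hvel := hasVelocityAt_chartAt_symm (M := M) (p := x) hβ (by rwa [hb])
  refine ⟨fun s ↦ (chartAt E x).symm (z + s • w), by simp only [hb, hzx], hvel.continuousAt,
    fun f hf ↦ ?_⟩
  have h1 : HasDerivAt (fun s : ℝ ↦ f ((chartAt E x).symm (z + s • w)))
      (dirDeriv f ((chartAt E x).symm (z + (0 : ℝ) • w))
        (frame x ((chartAt E x).symm (z + (0 : ℝ) • w)) w)) 0 :=
    hvel.hasDerivAt_comp (f := f) (by simpa only [hb, hzx] using hf)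
  rwa [hb, hzx] at h1

/-- Leibniz rule for a locally finite convex combination: the derivatives of the weights only see
the differences to a common value. -/
theorem SmoothPartitionOfUnity.dirDeriv_finsum_smul {ι : Type*}
    (ρ : SmoothPartitionOfUnity ι 𝓘(ℝ, E) M univ) {F : ι → M → ℝ} {x : M}
    (hF : ∀ i ∈ ρ.fintsupport x, MDifferentiableAt 𝓘(ℝ, E) 𝓘(ℝ, ℝ) (F i) x)
    (hd : MDifferentiableAt 𝓘(ℝ, E) 𝓘(ℝ, ℝ) (fun y ↦ ∑ᶠ i, ρ i y • F i y) x)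
    (a : ℝ) (v : TangentSpace 𝓘(ℝ, E) x) :
    dirDeriv (fun y ↦ ∑ᶠ i, ρ i y • F i y) x v = ∑ i ∈ ρ.fintsupport x,
      (dirDeriv (ρ i) x v * (F i x - a) + ρ i x * dirDeriv (F i) x v) := by
  obtain ⟨γ, hγ0, hγc, hγ⟩ := exists_curve_hasDerivAt_dirDeriv v
  have hρ : ∀ i, HasDerivAt (fun s ↦ ρ i (γ s)) (dirDeriv (ρ i) x v) 0 := fun i ↦
    hγ _ ((ρ i).contMDiff.mdifferentiableAt (by simp))
  have hev : ∀ᶠ s in 𝓝 (0 : ℝ), ρ.finsupport (γ s) ⊆ ρ.fintsupport x := by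
    have := ρ.eventually_finsupport_subset x
    rw [← hγ0] at this ⊢
    exact hγc.eventually this
  have h1 : HasDerivAt (fun s ↦ ∑ i ∈ ρ.fintsupport x, ρ i (γ s) * F i (γ s))
      (∑ i ∈ ρ.fintsupport x, (dirDeriv (ρ i) x v * F i x + ρ i x * dirDeriv (F i) x v)) 0 := by
    refine HasDerivAt.fun_sum fun i hi ↦ ?_
    have := (hρ i).mul (hγ _ (hF i hi))
    rwa [hγ0] at this
  have h2 : HasDerivAt (fun s ↦ ∑ i ∈ ρ.fintsupport x, ρ i (γ s))
      (∑ i ∈ ρ.fintsupport x, dirDeriv (ρ i) x v) 0 :=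
    HasDerivAt.fun_sum fun i _ ↦ hρ i
  have h3 : (fun s ↦ ∑ i ∈ ρ.fintsupport x, ρ i (γ s)) =ᶠ[𝓝 0] fun _ ↦ 1 := by
    filter_upwards [hev] with s hs
    exact ρ.sum_finsupport' _ (mem_univ _) hs
  -- Derivative of the constant sum of the weights; this is why any `a` may be subtracted from the
  -- `F i x`.
  have h4 : (∑ i ∈ ρ.fintsupport x, dirDeriv (ρ i) x v) = 0 :=
    h2.unique ((hasDerivAt_const (0 : ℝ) (1 : ℝ)).congr_of_eventuallyEq h3)
  have h5 : (fun s ↦ ∑ᶠ i, ρ i (γ s) • F i (γ s)) =ᶠ[𝓝 0]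
      fun s ↦ ∑ i ∈ ρ.fintsupport x, ρ i (γ s) * F i (γ s) := by
    filter_upwards [hev] with s hs
    refine finsum_eq_sum_of_support_subset _ fun i hi ↦ hs ?_
    rw [ρ.mem_finsupport]
    intro h0
    exact hi (by simp only [h0, zero_smul])
  rw [(hγ _ hd).unique (h1.congr_of_eventuallyEq h5)]
  have h6 : ∑ i ∈ ρ.fintsupport x, dirDeriv (ρ i) x v * a = 0 := by
    rw [← Finset.sum_mul, h4, zero_mul]
  rw [← sub_zero (∑ i ∈ ρ.fintsupport x, _), ← h6, ← Finset.sum_sub_distrib]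
  exact Finset.sum_congr rfl fun i _ ↦ by ring

/-- Each `b i` is at most the smallest `c j` over `J.card + 1`, so their sum stays below that
minimum, hence below the weighted mean. The `+ 1` makes this strict. -/
theorem sum_lt_of_forall_le_div {ι : Type*} {J : Finset ι} {ρ c b : ι → ℝ} (hc : ∀ i ∈ J, 0 < c i)
    (hρ : ∀ i ∈ J, 0 ≤ ρ i) (hsum : ∑ i ∈ J, ρ i = 1)
    (hb : ∀ i ∈ J, ∀ j ∈ J, b i ≤ c j / (J.card + 1)) : ∑ i ∈ J, b i < ∑ i ∈ J, ρ i * c i := by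
  have hne : J.Nonempty := by
    rw [Finset.nonempty_iff_ne_empty]
    rintro rfl
    simp at hsum
  obtain ⟨j, hj, hmin⟩ := J.exists_min_image c hne
  have hcard : (0 : ℝ) ≤ J.card := Nat.cast_nonneg _
  calc ∑ i ∈ J, b i ≤ ∑ _i ∈ J, c j / (J.card + 1) := Finset.sum_le_sum fun i hi ↦ hb i hi j hj
    _ = J.card * c j / (J.card + 1) := by rw [Finset.sum_const, nsmul_eq_mul, mul_div_assoc]
    _ < c j := by
      rw [div_lt_iff₀ (by positivity)]
      linarith [hc j hj]
    _ = ∑ i ∈ J, ρ i * c j := by rw [← Finset.sum_mul, hsum, one_mul]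
    _ ≤ ∑ i ∈ J, ρ i * c i :=
      Finset.sum_le_sum fun i hi ↦ mul_le_mul_of_nonneg_left (hmin i hi) (hρ i hi)

theorem mul_le_div_add_one {a e m c n k : ℝ} (ha : 0 ≤ a) (he : 0 ≤ e)
    (hem : e ≤ m / ((a + 1) * (k + 1))) (hm : 0 < m) (hmc : m ≤ c) (hn : 0 ≤ n) (hnk : n ≤ k) :
    a * e ≤ c / (n + 1) := by
  have hk : 0 ≤ k := hn.trans hnk
  calc a * e ≤ (a + 1) * (m / ((a + 1) * (k + 1))) :=
        mul_le_mul (by linarith) hem he (by linarith)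
    _ = m / (k + 1) := by field_simp
    _ ≤ c / (n + 1) := div_le_div₀ (hm.le.trans hmc) hmc (by positivity) (by linarith)

theorem exists_smooth_approximation [FiniteDimensional ℝ E] [T2Space M] [SigmaCompactSpace M]
    {h : SmoothRiemannianMetric E M} {g g' : LorentzMetric E M} {T : TimeOrientation g}
    {hg : Wider g g'} {τ : M → ℝ} (hτ : IsLocallyAntiLipschitz h g' (T.widen hg) τ)
    (hcont : Continuous τ) {α : M → ℝ}
    (hα : ∀ K : Set M, IsCompact K → ∃ c : ℝ, 0 < c ∧ ∀ p ∈ K, c ≤ α p) :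
    ∃ τ' : M → ℝ, ContMDiff 𝓘(ℝ, E) 𝓘(ℝ, ℝ) ∞ τ' ∧ (∀ p, |τ' p - τ p| < α p) ∧
      ∀ (p : M) (v : TangentSpace 𝓘(ℝ, E) p), IsFutureCausal g T v → 0 < dirDeriv τ' p v := by
  choose U hUo hpU hUc c hc hsm using fun p ↦ hτ.exists_local_smoothing hcont p
  choose a ha haα using fun p ↦ hα _ (hUc p)
  obtain ⟨ρ, hρU⟩ := SmoothPartitionOfUnity.exists_isSubordinate 𝓘(ℝ, E) (isClosed_univ (X := M))
    U hUo fun x _ ↦ mem_iUnion_of_mem x (hpU x)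
  have hK : ∀ q, IsCompact (tsupport (ρ q)) := fun q ↦
    (hUc q).of_isClosed_subset (isClosed_tsupport _) ((hρU q).trans subset_closure)
  choose A hA hAρ using fun q ↦ exists_abs_dirDeriv_le h (ρ q).contMDiff (hK q)
  have hfin : ∀ q, {i | (tsupport (ρ i) ∩ tsupport (ρ q)).Nonempty}.Finite := fun q ↦
    ρ.locallyFinite.closure.finite_nonempty_inter_compact (hK q)
  set N : M → Finset M := fun q ↦ (hfin q).toFinset with hN
  have hm : ∀ q, ∃ m : ℝ, 0 < m ∧ ∀ i ∈ N q, m ≤ c i := by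
    intro q
    classical
    -- Inserting `q` keeps the set nonempty even when the support of `ρ q` is empty.
    refine ⟨(insert q (N q)).inf' (Finset.insert_nonempty _ _) c, ?_, fun i hi ↦ ?_⟩
    · rw [Finset.lt_inf'_iff]
      exact fun i _ ↦ hc i
    · exact Finset.inf'_le _ (Finset.mem_insert_of_mem hi)
  choose m hm0 hmc using hm
  -- The first bound gives closeness to `τ`. The second makes `A q * ε q` small against the rate of
  -- every neighbour of `q`, divided among all the functions active at a point.
  set ε : M → ℝ := fun q ↦ min (a q / 2) (m q / ((A q + 1) * ((N q).card + 1))) with hε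
  have hε0 : ∀ q, 0 < ε q := by
    intro q
    have := ha q
    have := hA q
    have := hm0 q
    exact lt_min (by positivity) (by positivity)
  choose F hFs hFε hFd using fun q ↦ hsm q (ε q) (hε0 q)
  have hsmooth : ContMDiff 𝓘(ℝ, E) 𝓘(ℝ, ℝ) ∞ (fun x ↦ ∑ᶠ q, ρ q x • F q x) :=
    ρ.contMDiff_finsum_smul fun q x hx ↦ hFs q x (hρU q hx)
  refine ⟨_, hsmooth, fun x ↦ ?_, fun x v hv ↦ ?_⟩
  · have : ∑ᶠ q, ρ q x • F q x ∈ Metric.ball (τ x) (α x) := by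
      refine ρ.finsum_smul_mem_convex (mem_univ x) (fun q hq ↦ ?_) (convex_ball _ _)
      have hxU : x ∈ U q := hρU q (subset_tsupport _ hq)
      rw [Metric.mem_ball, Real.dist_eq]
      have h1 := hFε q x hxU
      have h2 := min_le_left (a q / 2) (m q / ((A q + 1) * ((N q).card + 1)))
      have h3 := haα q x (subset_closure hxU)
      have h4 := ha q
      calc |F q x - τ x| ≤ a q / 2 := h1.trans h2
        _ < α x := by linarith
    rwa [Metric.mem_ball, Real.dist_eq] at this
  · have hmemU : ∀ q ∈ ρ.fintsupport x, x ∈ tsupport (ρ q) := fun q hq ↦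
      (ρ.mem_fintsupport_iff x q).1 hq
    -- With `τ x` as the common value, the derivative of `ρ q` only multiplies an error of size at
    -- most `ε q`.
    rw [SmoothPartitionOfUnity.dirDeriv_finsum_smul ρ (fun q hq ↦
      (hFs q x (hρU q (hmemU q hq))).mdifferentiableAt (by simp))
      (hsmooth.mdifferentiableAt (by simp)) (τ x) v]
    have hn : 0 < hnorm h v := hnorm_pos h hv.1.1
    have hJN : ∀ q ∈ ρ.fintsupport x, ρ.fintsupport x ⊆ N q := by
      intro q hq i hi
      rw [hN, Finite.mem_toFinset]
      exact ⟨x, hmemU i hi, hmemU q hq⟩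
    have hlt : ∑ q ∈ ρ.fintsupport x, A q * ε q < ∑ q ∈ ρ.fintsupport x, ρ q x * c q := by
      refine sum_lt_of_forall_le_div (fun i _ ↦ hc i) (fun i _ ↦ ρ.nonneg i x)
        (ρ.sum_finsupport' x (mem_univ x) (ρ.finsupport_subset_fintsupport x)) fun q hq j hj ↦ ?_
      exact mul_le_div_add_one (hA q) (hε0 q).le (min_le_right _ _) (hm0 q)
        (hmc q j (hJN q hq hj)) (Nat.cast_nonneg _)
        (Nat.cast_le.2 (Finset.card_le_card (hJN q hq)))
    have hterm : ∀ q ∈ ρ.fintsupport x, ρ q x * c q * hnorm h v - A q * ε q * hnorm h v ≤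
        dirDeriv (ρ q) x v * (F q x - τ x) + ρ q x * dirDeriv (F q) x v := by
      intro q hq
      have hxK := hmemU q hq
      have hxU : x ∈ U q := hρU q hxK
      have h1 := mul_le_mul_of_nonneg_left (hFd q x hxU v hv) (ρ.nonneg q x)
      have h2 : |dirDeriv (ρ q) x v * (F q x - τ x)| ≤ A q * hnorm h v * ε q := by
        rw [abs_mul]
        exact mul_le_mul (hAρ q x hxK v) (hFε q x hxU) (abs_nonneg _)
          (mul_nonneg (hA q) hn.le)
      have h3 := (abs_le.1 h2).1
      linarith
    refine lt_of_lt_of_le ?_ (Finset.sum_le_sum hterm)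
    rw [Finset.sum_sub_distrib, ← Finset.sum_mul, ← Finset.sum_mul, ← sub_mul]
    exact mul_pos (sub_pos.2 hlt) hn

end Gluing

end Spacetime

/-! ### The main theorem -/

open Spacetime in
theorem mainTheorem2
    {E : Type*} [NormedAddCommGroup E] [NormedSpace ℝ E] [FiniteDimensional ℝ E]
    {M : Type*} [TopologicalSpace M] [ChartedSpace E M] [IsManifold 𝓘(ℝ, E) ∞ M]
    [T2Space M] [SecondCountableTopology M] [ConnectedSpace M]
    (h : SmoothRiemannianMetric E M)
    (g : LorentzMetric E M) (T : TimeOrientation g) (hstable : IsStablyCausal g T)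
    (τ : M → ℝ) (hτ : IsTimeFunction g T τ)
    (hanti : ∃ (g' : LorentzMetric E M) (hg : Wider g g'),
      IsLocallyAntiLipschitz h g' (T.widen hg) τ)
    (α : M → ℝ) (hα : ∀ K : Set M, IsCompact K → ∃ c : ℝ, 0 < c ∧ ∀ p ∈ K, c ≤ α p) :
    ∃ τ' : M → ℝ, ContMDiff 𝓘(ℝ, E) 𝓘(ℝ, ℝ) ∞ τ' ∧ IsTimeFunction g T τ' ∧
      HasTimelikeGradient g τ' ∧ (∀ p, |τ' p - τ p| < α p) ∧
      (IsCauchyTimeFunction g T τ → IsCauchyTimeFunction g T τ') := by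
  have : LocallyCompactSpace M := ChartedSpace.locallyCompactSpace E M
  obtain ⟨g', hg, hanti⟩ := hanti
  -- Capping the tolerance at `1` keeps `τ'` at bounded distance from `τ`, as the Cauchy property
  -- requires.
  have hα' : ∀ K : Set M, IsCompact K → ∃ c : ℝ, 0 < c ∧ ∀ p ∈ K, c ≤ min (α p) 1 := by
    intro K hK
    obtain ⟨c, hc, hcK⟩ := hα K hK
    exact ⟨min c 1, lt_min hc one_pos, fun p hp ↦ min_le_min (hcK p hp) le_rfl⟩
  obtain ⟨τ', hsm, happ, hpos⟩ := exists_smooth_approximation hanti hτ.1 hα'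
  have htime : IsTimeFunction g T τ' := isTimeFunction_of_dirDeriv_pos hsm hpos
  refine ⟨τ', hsm, htime, fun p ↦ ?_, fun p ↦ (happ p).trans_le (min_le_left _ _), fun hC ↦
    hC.of_abs_sub_lt htime fun p ↦ (happ p).trans_le (min_le_right _ _)⟩
  obtain ⟨u, hu, hu'⟩ := exists_timelike_gradient T
    (mfderiv 𝓘(ℝ, E) 𝓘(ℝ, ℝ) τ' p).toLinearMap (hpos p)
  exact ⟨u, hu, hu'⟩
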